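/- Setting. Fix a class of source manifolds: for every finite family $\mathcal B=B_1\sqcup\dots\sqcup B_k$ of boundary manifolds a set $Y_{\mathcal B}$ of (isomorphism classes of) source manifolds with boundary $\mathcal B$, the case $\mathcal B=\emptyset$ being the set $X$ of closed source manifolds. They can be formed into disjoint unions, sewn together along boundary components carrying the same boundary manifold, and complex-conjugated ($N\mapsto N^*$), with the usual rules (the result depends only on which components are sewn to which; ${}^*$ is an involution compatible with unions and sewing). For each $B$ there are cylinders $C_\epsilon=B\times[0,\epsilon]$, $\epsilon>0$, that are invariant under conjugation combined with reflection and satisfy $C_\epsilon C_\delta=C_{\epsilon+\delta}$; and surfaces are rimmed: every $N\in Y_{B_1\sqcup B_2}$ can be written as $N=C_\epsilon N'$, and as $N=N''C_{\delta}$, for some $\epsilon,\delta>0$ and $N',N''\in Y_{B_1\sqcup B_2}$. For $a\in Y_{B_1\sqcup B_2}$, $b\in Y_{B_2\sqcup B_3}$, $ab\in Y_{B_1\sqcup B_3}$ denotes the result of sewing the right boundary of $a$ to the left boundary of $b$. Let $\zeta:X\to\mathbb C$ be a path integral satisfying reality ($\zeta(M^*)=\overline{\zeta(M)}$), reflection-positivity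 ($\sum_{I,J}\bar\gamma_I\gamma_J\,\zeta(N_I^*N_J)\ge 0$ for all finite families $N_I\in Y_{\mathcal B}$, $\gamma_I\in\mathbb C$, where $N_I^*N_J$ is sewn along all of $\mathcal B$), continuity of $\zeta$ in the length $\epsilon>0$ of any cylinder contained in a closed source manifold, and factorization ($\zeta(M_1\sqcup M_2)=\zeta(M_1)\zeta(M_2)$). Let $H_{\mathcal B}$ be the space of finite formal complex linear combinations of elements of $Y_{\mathcal B}$ with the pre-inner product $\langle N_1|N_2\rangle=\zeta(N_1^*N_2)$, $\mathcal D_{\mathcal B}$ its quotient by the null vectors, and $\mathcal H_{\mathcal B}$ the Hilbert space completion of $\mathcal D_{\mathcal B}$; write $|x\rangle$ for the class of $x$. Let $B_L,B_R$ be boundary manifolds, $LL=B_L\sqcup B_L$, $LR=B_L\sqcup B_R$. For $a\in H_{LR}$ let $\hat a_R\in\mathcal B(\mathcal H_{LL},\mathcal H_{LR})$ be the bounded operator with $\hat a_R|\phi\rangle=|\phi a\rangle$ for $\phi\in H_{LL}$; it depends only on $|a\rangle$, and $\Psi_R:\mathcal D_{LR}\to\mathcal B(\mathcal H_{LL},\mathcal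 H_{LR})$ is the linear map $|a\rangle\mapsto\hat a_R$. For $a\in H_{LL}$ let $\hat a_L$ be the bounded operator $|\phi\rangle\mapsto|a\phi\rangle$ on $\mathcal H_{LL}$, respectively on $\mathcal H_{LR}$, and let $\mathcal A_L^{LL}\subseteq\mathcal B(\mathcal H_{LL})$, respectively $\mathcal A_L^{LR}\subseteq\mathcal B(\mathcal H_{LR})$, be the closure of the set of all these $\hat a_L$ in the weak operator topology. For $a\in\mathcal A_L^{LL}$ let $\Phi_{LR}(a)\in\mathcal B(\mathcal H_{LR})$ be the unique bounded operator with $\Phi_{LR}(a)|C_\epsilon\phi\rangle=\hat\phi_R\,a\,|C_\epsilon\rangle$ for all $\epsilon>0$ and $\phi\in H_{LR}$. Theorem. (1) $\Psi_R:\mathcal D_{LR}\to\mathcal B(\mathcal H_{LL},\mathcal H_{LR})$ is continuous with respect to the norm topology of $\mathcal H_{LR}$ on $\mathcal D_{LR}$ and the strong operator topology on $\mathcal B(\mathcal H_{LL},\mathcal H_{LR})$, and it has a unique continuous extension (for the same topologies) to all of $\mathcal H_{LR}$. This extension, again called $\Psi_R$, is linear; write $\hat\psi_R=\Psi_R(|\psi\rangle)$.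 (2) $\Phi_{LR}$ maps $\mathcal A_L^{LL}$ into $\mathcal A_L^{LR}$, and for every $|\psi\rangle\in\mathcal H_{LR}$ the operator $\hat\psi_R:\mathcal H_{LL}\to\mathcal H_{LR}$ intertwines the two algebras: $$\Phi_{LR}(a)\,\hat\psi_R=\hat\psi_R\,a\qquad\text{for all }a\in\mathcal A_L^{LL}.$$ -/

import Mathlib

open scoped ComplexOrder InnerProductSpace

universe u v

/-- A sewing pattern from labelled boundary components `c : ι → Bdry` to `d : κ → Bdry`.
`pair` is an involution of the labels: labels exchanged by `pair` are sewn to each other (they must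
carry the same boundary manifold), labels fixed by `pair` survive, and `keep` gives the surviving
components their new labels. -/
@[ext]
structure Sewing {Bdry : Type u} {ι κ : Type} (c : ι → Bdry) (d : κ → Bdry) where
  keep : κ → ι
  pair : ι → ι
  pair_pair : ∀ i, pair (pair i) = i
  keep_injective : Function.Injective keep
  pair_eq_iff : ∀ i, pair i = i ↔ i ∈ Set.range keep
  color_pair : ∀ i, c (pair i) = c i
  color_keep : ∀ k, c (keep k) = d k

namespace Sewing

variable {Bdry : Type u} {ι κ μ ι' κ' : Type}

/-- `U` is the pattern "first sew along `S`, then along `T`". -/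
structure IsComp {c : ι → Bdry} {d : κ → Bdry} {e : μ → Bdry}
    (S : Sewing c d) (T : Sewing d e) (U : Sewing c e) : Prop where
  keep_eq : ∀ m, U.keep m = S.keep (T.keep m)
  pair_keep : ∀ k, U.pair (S.keep k) = S.keep (T.pair k)
  pair_eq : ∀ i, S.pair i ≠ i → U.pair i = S.pair i

/-- The pattern that sews nothing and only renames the labels. -/
def rename {c : ι → Bdry} {d : κ → Bdry} (e : κ ≃ ι) (h : ∀ k, c (e k) = d k) : Sewing c d where
  keep := e
  pair := id
  pair_pair _ := rfl
  keep_injective := e.injective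
  pair_eq_iff i := by simp
  color_pair _ := rfl
  color_keep := h

theorem color_comm (c : ι → Bdry) (d : κ → Bdry) (k : κ ⊕ ι) :
    Sum.elim c d (Equiv.sumComm κ ι k) = Sum.elim d c k := by
  rcases k with k | k <;> rfl

theorem color_assoc (c : ι → Bdry) (d : κ → Bdry) (e : μ → Bdry) (k : ι ⊕ (κ ⊕ μ)) :
    Sum.elim (Sum.elim c d) e ((Equiv.sumAssoc ι κ μ).symm k) = Sum.elim c (Sum.elim d e) k := by
  rcases k with k | k | k <;> rfl

/-- The pattern that renames the labels of `N ⊔ M` as those of `M ⊔ N`. -/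
def comm (c : ι → Bdry) (d : κ → Bdry) : Sewing (Sum.elim c d) (Sum.elim d c) :=
  rename (Equiv.sumComm κ ι) (color_comm c d)

/-- The pattern that renames the labels of `(M ⊔ N) ⊔ P` as those of `M ⊔ (N ⊔ P)`. -/
def assoc (c : ι → Bdry) (d : κ → Bdry) (e : μ → Bdry) :
    Sewing (Sum.elim (Sum.elim c d) e) (Sum.elim c (Sum.elim d e)) :=
  rename (Equiv.sumAssoc ι κ μ).symm (color_assoc c d e)

/-- The pattern that does nothing. -/
def refl (c : ι → Bdry) : Sewing c c := rename (Equiv.refl ι) fun _ => rfl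

/-- Two patterns applied to the two parts of a disjoint union. -/
def sum {c : ι → Bdry} {d : κ → Bdry} {c' : ι' → Bdry} {d' : κ' → Bdry}
    (S : Sewing c d) (T : Sewing c' d') : Sewing (Sum.elim c c') (Sum.elim d d') where
  keep := Sum.map S.keep T.keep
  pair := Sum.map S.pair T.pair
  pair_pair := by rintro (i | i) <;> simp [S.pair_pair, T.pair_pair]
  keep_injective := S.keep_injective.sumMap T.keep_injective
  pair_eq_iff := by
    rintro (i | i)
    · simp only [Sum.map_inl, Sum.inl.injEq, S.pair_eq_iff]; simp
    · simp only [Sum.map_inr, Sum.inr.injEq, T.pair_eq_iff]; simp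
  color_pair := by rintro (i | i) <;> simp [S.color_pair, T.color_pair]
  color_keep := by rintro (i | i) <;> simp [S.color_keep, T.color_keep]

/-- Sew the right boundary of a surface with boundary `B₁ ⊔ B₂` to the left boundary of a surface
with boundary `B₂ ⊔ B₃` (label `0` is the left boundary, label `1` the right one). -/
def glueMid (B₁ B₂ B₃ : Bdry) : Sewing (Sum.elim ![B₁, B₂] ![B₂, B₃]) ![B₁, B₃] where
  keep := ![Sum.inl 0, Sum.inr 1]
  pair := Sum.elim ![Sum.inl 0, Sum.inr 0] ![Sum.inl 1, Sum.inr 1]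
  pair_pair := by decide
  keep_injective := by decide
  pair_eq_iff := by simp only [Set.mem_range]; decide
  color_pair := by rintro (i | i) <;> fin_cases i <;> rfl
  color_keep := by intro k; fin_cases k <;> rfl

/-- Sew two surfaces with the same boundary along their whole boundary. -/
def close (c : ι → Bdry) : Sewing (Sum.elim c c) (Empty.elim : Empty → Bdry) where
  keep := Empty.elim
  pair := Sum.swap
  pair_pair := Sum.swap_swap
  keep_injective := fun x => x.elim
  pair_eq_iff := by rintro (i | i) <;> simp
  color_pair := by rintro (i | i) <;> rfl
  color_keep := fun x => x.elim

/-- Interchange the names "left" and "right" of two boundaries. -/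
def flip (B₁ B₂ : Bdry) : Sewing ![B₁, B₂] ![B₂, B₁] :=
  rename (Equiv.swap 0 1) (by intro k; fin_cases k <;> rfl)

/-- The disjoint union of two closed manifolds is closed. -/
def closedSum : Sewing (Sum.elim (Empty.elim : Empty → Bdry) (Empty.elim : Empty → Bdry))
    (Empty.elim : Empty → Bdry) :=
  rename (Equiv.equivOfIsEmpty _ _) (fun x => x.elim)

end Sewing

/-- A class of source manifolds with rimmed, labelled boundary, up to isomorphism (isomorphisms
preserve the sources and the identification of the boundary components with their labels), closed
under the operations of cutting and pasting. The kind of manifold and the kind of sources are left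
open: the structure records the operations and the way they combine.

* `Bdry`: the boundary manifolds `B` under discussion (possibly empty or disconnected);
* `Surf c`: the source manifolds whose boundary is the disjoint union of the `c i`, `i : ι`;
  the closed source manifolds are the case `ι = Empty`;
* `union`, `sew`: disjoint union, and sewing together boundary components / renaming labels;
* `conj`: complex conjugation of the sources, with reflection about the boundary;
* `cyl B ε`: the cylinder `B × [0, ε]`, for `0 < ε`.

The laws say that the result of cutting and pasting depends only on which pieces are sewn to which,
that `conj` is an involution compatible with cutting and pasting, that cylinders are
reflection-symmetric and add up, and that all surfaces with a left and a right boundary are rimmed: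
a cylinder can be split off at either boundary. -/
structure SourceManifolds where
  Bdry : Type u
  Surf : ∀ {ι : Type} [Finite ι], (ι → Bdry) → Type v
  union : ∀ {ι κ : Type} [Finite ι] [Finite κ] {c : ι → Bdry} {d : κ → Bdry},
    Surf c → Surf d → Surf (Sum.elim c d)
  sew : ∀ {ι κ : Type} [Finite ι] [Finite κ] {c : ι → Bdry} {d : κ → Bdry},
    Sewing c d → Surf c → Surf d
  conj : ∀ {ι : Type} [Finite ι] {c : ι → Bdry}, Surf c → Surf c
  cyl : ∀ B : Bdry, ℝ → Surf ![B, B]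
  sew_refl : ∀ {ι : Type} [Finite ι] {c : ι → Bdry} (M : Surf c),
    sew (Sewing.refl c) M = M
  sew_sew : ∀ {ι κ μ : Type} [Finite ι] [Finite κ] [Finite μ]
    {c : ι → Bdry} {d : κ → Bdry} {e : μ → Bdry} {S : Sewing c d} {T : Sewing d e} {U : Sewing c e},
    S.IsComp T U → ∀ M : Surf c, sew T (sew S M) = sew U M
  union_comm : ∀ {ι κ : Type} [Finite ι] [Finite κ] {c : ι → Bdry} {d : κ → Bdry}
    (M : Surf c) (N : Surf d),
    union N M = sew (Sewing.comm c d) (union M N)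
  union_assoc : ∀ {ι κ μ : Type} [Finite ι] [Finite κ] [Finite μ]
    {c : ι → Bdry} {d : κ → Bdry} {e : μ → Bdry} (M : Surf c) (N : Surf d) (P : Surf e),
    union M (union N P) = sew (Sewing.assoc c d e) (union (union M N) P)
  union_sew : ∀ {ι κ ι' κ' : Type} [Finite ι] [Finite κ] [Finite ι'] [Finite κ']
    {c : ι → Bdry} {d : κ → Bdry} {c' : ι' → Bdry} {d' : κ' → Bdry}
    (S : Sewing c d) (T : Sewing c' d') (M : Surf c) (N : Surf c'),
    union (sew S M) (sew T N) = sew (S.sum T) (union M N)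
  conj_conj : ∀ {ι : Type} [Finite ι] {c : ι → Bdry} (M : Surf c), conj (conj M) = M
  conj_union : ∀ {ι κ : Type} [Finite ι] [Finite κ] {c : ι → Bdry} {d : κ → Bdry}
    (M : Surf c) (N : Surf d), conj (union M N) = union (conj M) (conj N)
  conj_sew : ∀ {ι κ : Type} [Finite ι] [Finite κ] {c : ι → Bdry} {d : κ → Bdry}
    (S : Sewing c d) (M : Surf c), conj (sew S M) = sew S (conj M)
  cyl_star : ∀ (B : Bdry) (ε : ℝ), 0 < ε → conj (sew (Sewing.flip B B) (cyl B ε)) = cyl B ε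
  cyl_add : ∀ (B : Bdry) (ε δ : ℝ), 0 < ε → 0 < δ →
    sew (Sewing.glueMid B B B) (union (cyl B ε) (cyl B δ)) = cyl B (ε + δ)
  rim_left : ∀ {B₁ B₂ : Bdry} (M : Surf ![B₁, B₂]), ∃ ε : ℝ, 0 < ε ∧ ∃ M' : Surf ![B₁, B₂],
    M = sew (Sewing.glueMid B₁ B₁ B₂) (union (cyl B₁ ε) M')
  rim_right : ∀ {B₁ B₂ : Bdry} (M : Surf ![B₁, B₂]), ∃ ε : ℝ, 0 < ε ∧ ∃ M' : Surf ![B₁, B₂],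
    M = sew (Sewing.glueMid B₁ B₂ B₂) (union M' (cyl B₂ ε))

namespace SourceManifolds

variable (S : SourceManifolds.{u, v})

/-- The closed source manifolds `X^d`. -/
abbrev Closed : Type v := S.Surf (Empty.elim : Empty → S.Bdry)

variable {S}
variable {ι κ : Type} [Finite ι] [Finite κ] {c : ι → S.Bdry} {d : κ → S.Bdry}

/-- Sew `M` and `N` along their whole boundary. -/
def pairing (M N : S.Surf c) : S.Closed := S.sew (Sewing.close c) (S.union M N)

/-- The product of surfaces: sew the right boundary of `M` to the left boundary of `N`. -/
def prod {B₁ B₂ B₃ : S.Bdry} (M : S.Surf ![B₁, B₂]) (N : S.Surf ![B₂, B₃]) : S.Surf ![B₁, B₃] :=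
  S.sew (Sewing.glueMid B₁ B₂ B₃) (S.union M N)

/-- The involution `⋆`: conjugate, and interchange left and right. -/
def star {B₁ B₂ : S.Bdry} (M : S.Surf ![B₁, B₂]) : S.Surf ![B₂, B₁] :=
  S.conj (S.sew (Sewing.flip B₁ B₂) M)

/-- The disjoint union of closed source manifolds. -/
def closedUnion (M N : S.Closed) : S.Closed := S.sew Sewing.closedSum (S.union M N)

theorem sew_eq_self {T : Sewing c c} (h : ∀ i, T.keep i = i) (M : S.Surf c) : S.sew T M = M := by
  have : T = Sewing.refl c := by
    ext i
    · exact h i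
    · exact (T.pair_eq_iff i).2 ⟨i, h i⟩
  rw [this, S.sew_refl]

theorem union_sew_right (T : Sewing c d) {μ : Type} [Finite μ] {e : μ → S.Bdry}
    (M : S.Surf e) (N : S.Surf c) :
    S.union M (S.sew T N) =
      S.sew ((Sewing.refl e).sum T) (S.union M N) := by
  rw [← S.union_sew, S.sew_refl]

theorem union_sew_left (T : Sewing c d) {μ : Type} [Finite μ] {e : μ → S.Bdry}
    (M : S.Surf e) (N : S.Surf c) :
    S.union (S.sew T N) M =
      S.sew (T.sum (Sewing.refl e)) (S.union N M) := by
  rw [← S.union_sew, S.sew_refl]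

theorem pairing_comm (M N : S.Surf c) : pairing M N = pairing N M := by
  unfold pairing
  rw [S.union_comm N M]
  refine S.sew_sew ⟨fun m => m.elim, ?_, ?_⟩ _
  · rintro (i | i) <;> rfl
  · intro i h; exact absurd rfl h

theorem conj_pairing (M N : S.Surf c) : S.conj (pairing M N) = pairing (S.conj M) (S.conj N) := by
  unfold pairing
  rw [S.conj_sew, S.conj_union]

theorem conj_prod {B₁ B₂ B₃ : S.Bdry} (M : S.Surf ![B₁, B₂]) (N : S.Surf ![B₂, B₃]) :
    S.conj (prod M N) = prod (S.conj M) (S.conj N) := by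
  unfold prod
  rw [S.conj_sew, S.conj_union]


/-- Successive sewings can be done at once. -/
theorem sew_sew_eq {μ : Type} [Finite μ] {e : μ → S.Bdry} {T : Sewing c d} {V : Sewing d e}
    (U : Sewing c e) (M : S.Surf c) (h₁ : ∀ m, U.keep m = T.keep (V.keep m))
    (h₂ : ∀ k, U.pair (T.keep k) = T.keep (V.pair k))
    (h₃ : ∀ i, T.pair i ≠ i → U.pair i = T.pair i) :
    S.sew V (S.sew T M) = S.sew U M := S.sew_sew ⟨h₁, h₂, h₃⟩ M

/-- `N` is `M` with its labels renamed through `f`. -/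
def IsRename (f : κ → ι) (M : S.Surf c) (N : S.Surf d) : Prop :=
  ∃ T : Sewing c d, (∀ k, T.keep k = f k) ∧ (∀ i, T.pair i = i) ∧ N = S.sew T M

theorem IsRename.trans {μ : Type} [Finite μ] {e : μ → S.Bdry} {f : κ → ι} {g : μ → κ}
    {M : S.Surf c} {N : S.Surf d} {P : S.Surf e} (h : IsRename f M N) (h' : IsRename g N P) :
    IsRename (f ∘ g) M P := by
  obtain ⟨T, hT, hT', rfl⟩ := h
  obtain ⟨V, hV, hV', rfl⟩ := h'
  refine ⟨⟨T.keep ∘ V.keep, id, fun _ => rfl, T.keep_injective.comp V.keep_injective, ?_,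
    fun _ => rfl, fun k => (T.color_keep _).trans (V.color_keep k)⟩, ?_, fun _ => rfl, ?_⟩
  · intro i
    obtain ⟨k, rfl⟩ := (T.pair_eq_iff i).1 (hT' i)
    obtain ⟨m, rfl⟩ := (V.pair_eq_iff k).1 (hV' k)
    simp
  · intro m
    simp [hT, hV]
  · exact sew_sew_eq _ _ (fun _ => rfl) (fun k => congrArg T.keep (hV' k).symm)
      (fun i h => absurd (hT' i) h)

theorem IsRename.union_left {μ : Type} [Finite μ] {e : μ → S.Bdry} {f : κ → ι}
    {M : S.Surf c} {N : S.Surf d} (h : IsRename f M N) (P : S.Surf e) :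
    IsRename (Sum.map f id) (S.union M P) (S.union N P) := by
  obtain ⟨T, hT, hT', rfl⟩ := h
  refine ⟨_, ?_, ?_, union_sew_left T P M⟩
  · rintro (k | k) <;> simp [Sewing.sum, hT]; rfl
  · rintro (k | k) <;> simp [Sewing.sum, hT']; rfl

theorem IsRename.union_right {μ : Type} [Finite μ] {e : μ → S.Bdry} {f : κ → ι}
    {M : S.Surf c} {N : S.Surf d} (h : IsRename f M N) (P : S.Surf e) :
    IsRename (Sum.map id f) (S.union P M) (S.union P N) := by
  obtain ⟨T, hT, hT', rfl⟩ := h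
  refine ⟨_, ?_, ?_, union_sew_right T P M⟩
  · rintro (k | k) <;> simp [Sewing.sum, hT]; rfl
  · rintro (k | k) <;> simp [Sewing.sum, hT']; rfl

theorem isRename_comm (M : S.Surf c) (N : S.Surf d) :
    IsRename Sum.swap (S.union M N) (S.union N M) :=
  ⟨_, fun _ => rfl, fun _ => rfl, S.union_comm M N⟩

theorem isRename_assoc {μ : Type} [Finite μ] {e : μ → S.Bdry}
    (M : S.Surf c) (N : S.Surf d) (P : S.Surf e) :
    IsRename (Equiv.sumAssoc ι κ μ).symm (S.union (S.union M N) P) (S.union M (S.union N P)) :=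
  ⟨_, fun _ => rfl, fun _ => rfl, S.union_assoc M N P⟩

theorem isRename_assoc_symm {μ : Type} [Finite μ] {e : μ → S.Bdry}
    (M : S.Surf c) (N : S.Surf d) (P : S.Surf e) :
    IsRename (Equiv.sumAssoc ι κ μ) (S.union M (S.union N P)) (S.union (S.union M N) P) := by
  refine ⟨Sewing.rename (Equiv.sumAssoc ι κ μ) (by rintro ((i | i) | i) <;> rfl),
    fun _ => rfl, fun _ => rfl, ?_⟩
  rw [S.union_assoc, sew_sew_eq (Sewing.refl _)]
  · exact (S.sew_refl _).symm
  · rintro ((i | i) | i) <;> rfl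
  · rintro (i | i | i) <;> rfl
  · intro i h; exact absurd rfl h

theorem isRename_interchange {μ ν : Type} [Finite μ] [Finite ν] {e : μ → S.Bdry} {f : ν → S.Bdry}
    (M : S.Surf c) (N : S.Surf d) (P : S.Surf e) (Q : S.Surf f) :
    IsRename (Equiv.sumSumSumComm ι κ μ ν) (S.union (S.union M P) (S.union N Q))
      (S.union (S.union M N) (S.union P Q)) := by
  have h := ((((isRename_assoc_symm (S.union M P) N Q).trans
    ((isRename_assoc M P N).union_left Q)).trans
    (((isRename_comm P N).union_right M).union_left Q)).trans
    ((isRename_assoc_symm M N P).union_left Q)).trans (isRename_assoc (S.union M N) P Q)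
  convert h using 1
  ext ((i | i) | (i | i)) <;> rfl

theorem pairing_union (M M' : S.Surf c) (N N' : S.Surf d) :
    pairing (S.union M N) (S.union M' N') = closedUnion (pairing M M') (pairing N N') := by
  obtain ⟨T, hT, hT', h⟩ := isRename_interchange M N M' N'
  unfold pairing closedUnion
  rw [h, S.union_sew]
  let U : Sewing (Sum.elim (Sum.elim c c) (Sum.elim d d)) (Empty.elim : Empty → S.Bdry) :=
    { keep := Empty.elim
      pair := Sum.map Sum.swap Sum.swap
      pair_pair := by rintro ((i | i) | (i | i)) <;> rfl
      keep_injective := fun x => x.elim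
      pair_eq_iff := by rintro ((i | i) | (i | i)) <;> simp
      color_pair := by rintro ((i | i) | (i | i)) <;> rfl
      color_keep := fun x => x.elim }
  rw [sew_sew_eq U, sew_sew_eq U]
  · exact fun k => k.elim
  · rintro (k | k) <;> exact k.elim
  · rintro ((i | i) | (i | i)) h <;> rfl
  · exact fun k => k.elim
  · rintro ((i | i) | (i | i)) <;> simp only [hT] <;> rfl
  · intro i h; exact absurd (hT' i) h

theorem prod_assoc {B₁ B₂ B₃ B₄ : S.Bdry} (M : S.Surf ![B₁, B₂]) (N : S.Surf ![B₂, B₃])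
    (P : S.Surf ![B₃, B₄]) : prod (prod M N) P = prod M (prod N P) := by
  obtain ⟨T, hT, hT', h⟩ := isRename_assoc M N P
  unfold prod
  rw [union_sew_left, union_sew_right, h]
  let U : Sewing (Sum.elim (Sum.elim ![B₁, B₂] ![B₂, B₃]) ![B₃, B₄]) ![B₁, B₄] :=
    { keep := ![.inl (.inl 0), .inr 1]
      pair := Sum.elim (Sum.elim ![.inl (.inl 0), .inl (.inr 0)] ![.inl (.inl 1), .inr 0])
        ![.inl (.inr 1), .inr 1]
      pair_pair := by decide
      keep_injective := by decide
      pair_eq_iff := by simp only [Set.mem_range]; decide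
      color_pair := by rintro ((i | i) | i) <;> fin_cases i <;> rfl
      color_keep := by intro i; fin_cases i <;> rfl }
  let V : Sewing (Sum.elim ![B₁, B₂] (Sum.elim ![B₂, B₃] ![B₃, B₄])) ![B₁, B₄] :=
    { keep := ![.inl 0, .inr (.inr 1)]
      pair := Sum.elim ![.inl 0, .inr (.inl 0)]
        (Sum.elim ![.inl 1, .inr (.inr 0)] ![.inr (.inl 1), .inr (.inr 1)])
      pair_pair := by decide
      keep_injective := by decide
      pair_eq_iff := by simp only [Set.mem_range]; decide
      color_pair := by rintro (i | i | i) <;> fin_cases i <;> rfl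
      color_keep := by intro i; fin_cases i <;> rfl }
  rw [sew_sew_eq U, sew_sew_eq V, sew_sew_eq U]
  · intro i; simp only [hT]; fin_cases i <;> rfl
  · rintro (i | i | i) <;> simp only [hT] <;> fin_cases i <;> rfl
  · intro i h; exact absurd (hT' i) h
  · intro i; fin_cases i <;> rfl
  · rintro (i | i) <;> fin_cases i <;> rfl
  · rintro (i | i | i) h <;> fin_cases i <;> first | rfl | exact absurd rfl h
  · intro i; fin_cases i <;> rfl
  · rintro (i | i) <;> fin_cases i <;> rfl
  · rintro ((i | i) | i) h <;> fin_cases i <;> first | rfl | exact absurd rfl h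

theorem color_swapMid {B₁ B₂ B₃ : S.Bdry} (k : Fin 2 ⊕ Fin 2) :
    Sum.elim ![B₁, B₂] ![B₂, B₃] (Equiv.swap (Sum.inl 1) (Sum.inr 0) k) =
      Sum.elim ![B₁, B₂] ![B₂, B₃] k := by
  rcases k with k | k <;> fin_cases k <;> rfl

/-- Interchange the labels of the two boundary components `B₂` of a surface with boundary
`(B₁ ⊔ B₂) ⊔ (B₂ ⊔ B₃)`. -/
def swapMid {B₁ B₂ B₃ : S.Bdry} (M : S.Surf (Sum.elim ![B₁, B₂] ![B₂, B₃])) :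
    S.Surf (Sum.elim ![B₁, B₂] ![B₂, B₃]) :=
  S.sew (Sewing.rename (Equiv.swap (Sum.inl 1) (Sum.inr 0)) color_swapMid) M

theorem pairing_prod_prod {B₁ B₂ B₃ : S.Bdry} (M M' : S.Surf ![B₁, B₂])
    (N N' : S.Surf ![B₂, B₃]) :
    pairing (prod M N) (prod M' N') = pairing (S.union M N') (swapMid (S.union M' N)) := by
  obtain ⟨T, hT, hT', h⟩ := isRename_interchange M N M' N'
  obtain ⟨T₂, hT₂, hT₂', h₂⟩ := ((isRename_comm N N').union_right (S.union M M')).trans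
    (isRename_interchange M N' M' N)
  unfold pairing prod swapMid
  rw [S.union_sew, union_sew_right, h, h₂]
  let U : Sewing (Sum.elim (Sum.elim ![B₁, B₂] ![B₂, B₃]) (Sum.elim ![B₁, B₂] ![B₂, B₃]))
      (Empty.elim : Empty → S.Bdry) :=
    { keep := Empty.elim
      pair := Sum.elim (Sum.elim ![.inr (.inl 0), .inl (.inr 0)] ![.inl (.inl 1), .inr (.inr 1)])
        (Sum.elim ![.inl (.inl 0), .inr (.inr 0)] ![.inr (.inl 1), .inl (.inr 1)])
      pair_pair := by decide
      keep_injective := fun x => x.elim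
      pair_eq_iff := by simp only [Set.mem_range]; decide
      color_pair := by rintro ((i | i) | (i | i)) <;> fin_cases i <;> rfl
      color_keep := fun x => x.elim }
  let U₂ : Sewing (Sum.elim (Sum.elim ![B₁, B₂] ![B₂, B₃]) (Sum.elim ![B₁, B₂] ![B₂, B₃]))
      (Empty.elim : Empty → S.Bdry) :=
    { keep := Empty.elim
      pair := Sum.elim (Sum.elim ![.inr (.inl 0), .inr (.inr 0)] ![.inr (.inl 1), .inr (.inr 1)])
        (Sum.elim ![.inl (.inl 0), .inl (.inr 0)] ![.inl (.inl 1), .inl (.inr 1)])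
      pair_pair := by decide
      keep_injective := fun x => x.elim
      pair_eq_iff := by simp only [Set.mem_range]; decide
      color_pair := by rintro ((i | i) | (i | i)) <;> fin_cases i <;> rfl
      color_keep := fun x => x.elim }
  let W : Sewing (Sum.elim (Sum.elim ![B₁, B₂] ![B₁, B₂]) (Sum.elim ![B₂, B₃] ![B₂, B₃]))
      (Empty.elim : Empty → S.Bdry) :=
    { keep := Empty.elim
      pair := Sum.elim (Sum.elim ![.inl (.inr 0), .inr (.inl 0)] ![.inl (.inl 0), .inr (.inr 0)])
        (Sum.elim ![.inl (.inl 1), .inr (.inr 1)] ![.inl (.inr 1), .inr (.inl 1)])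
      pair_pair := by decide
      keep_injective := fun x => x.elim
      pair_eq_iff := by simp only [Set.mem_range]; decide
      color_pair := by rintro ((i | i) | (i | i)) <;> fin_cases i <;> rfl
      color_keep := fun x => x.elim }
  rw [sew_sew_eq U, sew_sew_eq U₂, sew_sew_eq W, sew_sew_eq W]
  · exact fun k => k.elim
  · rintro ((i | i) | (i | i)) <;> simp only [hT₂] <;> fin_cases i <;> rfl
  · intro i h; exact absurd (hT₂' i) h
  · exact fun k => k.elim
  · rintro ((i | i) | (i | i)) <;> simp only [hT] <;> fin_cases i <;> rfl
  · intro i h; exact absurd (hT' i) h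
  · exact fun k => k.elim
  · rintro ((i | i) | (i | i)) <;> fin_cases i <;> rfl
  · rintro ((i | i) | (i | i)) h <;> fin_cases i <;> exact absurd rfl h
  · exact fun k => k.elim
  · rintro (i | i) <;> fin_cases i <;> rfl
  · rintro ((i | i) | (i | i)) h <;> fin_cases i <;> first | rfl | exact absurd rfl h

theorem pairing_prod_right {B₁ B₂ B₃ : S.Bdry} (P : S.Surf ![B₁, B₃]) (M : S.Surf ![B₁, B₂])
    (N : S.Surf ![B₂, B₃]) :
    pairing P (prod M N) = pairing (prod P (S.sew (Sewing.flip B₂ B₃) N)) M := by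
  obtain ⟨T, hT, hT', h⟩ := (isRename_assoc_symm P M N).trans
    ((isRename_comm P M).union_left N |>.trans (isRename_assoc M P N) |>.trans
      (isRename_comm M (S.union P N)))
  unfold pairing prod
  rw [union_sew_right, union_sew_right, union_sew_left, union_sew_left, h]
  let U : Sewing (Sum.elim ![B₁, B₃] (Sum.elim ![B₁, B₂] ![B₂, B₃]))
      (Empty.elim : Empty → S.Bdry) :=
    { keep := Empty.elim
      pair := Sum.elim ![.inr (.inl 0), .inr (.inr 1)]
        (Sum.elim ![.inl 0, .inr (.inr 0)] ![.inr (.inl 1), .inl 1])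
      pair_pair := by decide
      keep_injective := fun x => x.elim
      pair_eq_iff := by simp only [Set.mem_range]; decide
      color_pair := by rintro (i | i | i) <;> fin_cases i <;> rfl
      color_keep := fun x => x.elim }
  let V : Sewing (Sum.elim (Sum.elim ![B₁, B₃] ![B₂, B₃]) ![B₁, B₂])
      (Empty.elim : Empty → S.Bdry) :=
    { keep := Empty.elim
      pair := Sum.elim (Sum.elim ![.inr 0, .inl (.inr 1)] ![.inr 1, .inl (.inl 1)])
        ![.inl (.inl 0), .inl (.inr 0)]
      pair_pair := by decide
      keep_injective := fun x => x.elim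
      pair_eq_iff := by simp only [Set.mem_range]; decide
      color_pair := by rintro ((i | i) | i) <;> fin_cases i <;> rfl
      color_keep := fun x => x.elim }
  let V' : Sewing (Sum.elim (Sum.elim ![B₁, B₃] ![B₃, B₂]) ![B₁, B₂])
      (Empty.elim : Empty → S.Bdry) :=
    { keep := Empty.elim
      pair := Sum.elim (Sum.elim ![.inr 0, .inl (.inr 0)] ![.inl (.inl 1), .inr 1])
        ![.inl (.inl 0), .inl (.inr 1)]
      pair_pair := by decide
      keep_injective := fun x => x.elim
      pair_eq_iff := by simp only [Set.mem_range]; decide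
      color_pair := by rintro ((i | i) | i) <;> fin_cases i <;> rfl
      color_keep := fun x => x.elim }
  rw [sew_sew_eq U, sew_sew_eq V', sew_sew_eq V, sew_sew_eq U]
  · exact fun k => k.elim
  · rintro ((i | i) | i) <;> simp only [hT] <;> fin_cases i <;> rfl
  · intro i h; exact absurd (hT' i) h
  · exact fun k => k.elim
  · rintro ((i | i) | i) <;> fin_cases i <;> rfl
  · rintro ((i | i) | i) h <;> fin_cases i <;> exact absurd rfl h
  · exact fun k => k.elim
  · rintro (i | i) <;> fin_cases i <;> rfl
  · rintro ((i | i) | i) h <;> fin_cases i <;> first | rfl | exact absurd rfl h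
  · exact fun k => k.elim
  · rintro (i | i) <;> fin_cases i <;> rfl
  · rintro (i | i | i) h <;> fin_cases i <;> first | rfl | exact absurd rfl h

theorem pairing_rename (f : κ ≃ ι) (hf : ∀ k, c (f k) = d k) (M N : S.Surf c) :
    pairing (S.sew (Sewing.rename f hf) M) (S.sew (Sewing.rename f hf) N) = pairing M N := by
  unfold pairing
  rw [S.union_sew]
  refine S.sew_sew ⟨fun m => m.elim, ?_, ?_⟩ _
  · rintro (i | i) <;> rfl
  · rintro (i | i) h <;> exact absurd rfl h

end SourceManifolds

/-- A path integral `ζ` on closed source manifolds, satisfying finiteness (`ζ` is complex valued),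
reality, reflection-positivity, continuity and factorization. -/
structure PathIntegral (S : SourceManifolds.{u, v}) where
  ζ : S.Closed → ℂ
  reality : ∀ M : S.Closed, ζ (S.conj M) = (starRingEnd ℂ) (ζ M)
  reflection_positivity : ∀ {ι : Type} [Finite ι] (c : ι → S.Bdry) (n : ℕ) (γ : Fin n → ℂ)
    (N : Fin n → S.Surf c),
    0 ≤ ∑ I, ∑ J, (starRingEnd ℂ) (γ I) * γ J * ζ (SourceManifolds.pairing (S.conj (N I)) (N J))
  continuity : ∀ (B : S.Bdry) (N : S.Surf ![B, B]),
    ContinuousOn (fun ε : ℝ => ζ (SourceManifolds.pairing (S.cyl B ε) N)) (Set.Ioi 0)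
  factorization : ∀ M N : S.Closed, ζ (SourceManifolds.closedUnion M N) = ζ M * ζ N

noncomputable section

namespace PathIntegral

open SourceManifolds

variable {S : SourceManifolds.{u, v}} (Z : PathIntegral S)

/-- `H_𝓑`: formal finite linear combinations of source manifolds with boundary `𝓑 = ⨆ c i`, with
the pre-inner product `⟨N₁|N₂⟩ = ζ(N₁* N₂)`. -/
def PreH (_Z : PathIntegral S) {ι : Type} [Finite ι] (c : ι → S.Bdry) : Type v := S.Surf c →₀ ℂ

section PreH

variable {ι : Type} [Finite ι] (c : ι → S.Bdry)

instance : AddCommGroup (Z.PreH c) := inferInstanceAs (AddCommGroup (S.Surf c →₀ ℂ))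

instance : Module ℂ (Z.PreH c) := inferInstanceAs (Module ℂ (S.Surf c →₀ ℂ))

variable {c}

/-- A single surface as an element of `H_𝓑`. -/
def surf (N : S.Surf c) : Z.PreH c := Finsupp.single N (1 : ℂ)

/-- The linear map `H_𝓑 → V` with prescribed values on surfaces. -/
def lin {V : Type*} [AddCommGroup V] [Module ℂ V] (f : S.Surf c → V) : Z.PreH c →ₗ[ℂ] V :=
  Finsupp.linearCombination ℂ f

@[simp]
theorem lin_surf {V : Type*} [AddCommGroup V] [Module ℂ V] (f : S.Surf c → V) (N : S.Surf c) :
    Z.lin f (Z.surf N) = f N :=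
  (Finsupp.linearCombination_single ℂ (1 : ℂ) N).trans (one_smul ℂ (f N))

@[elab_as_elim]
theorem PreH.induction {p : Z.PreH c → Prop} (x : Z.PreH c) (h0 : p 0)
    (hadd : ∀ x y, p x → p y → p (x + y)) (hsurf : ∀ (a : ℂ) N, p (a • Z.surf N)) : p x := by
  refine Finsupp.induction_linear x h0 hadd fun N a => ?_
  have h : a • Z.surf N = (Finsupp.single N a : S.Surf c →₀ ℂ) := Finsupp.smul_single_one N a
  exact h ▸ hsurf a N

/-- Complex conjugation of the coefficients of a formal linear combination. -/
def coeffConj (x : Z.PreH c) : Z.PreH c :=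
  Finsupp.mapRange (starRingEnd ℂ) (map_zero _) (x : S.Surf c →₀ ℂ)

/-- The antilinear extension to `H_𝓑` of the conjugation of surfaces. -/
def conjH : Z.PreH c →ₛₗ[starRingEnd ℂ] Z.PreH c where
  toFun x := Z.lin (fun M => Z.surf (S.conj M)) (Z.coeffConj x)
  map_add' x y := by
    rw [← map_add]
    exact congrArg _ (Finsupp.mapRange_add (map_add (starRingEnd ℂ)) x y)
  map_smul' a x := by
    rw [← map_smul]
    refine congrArg _ ?_
    exact Finsupp.mapRange_smul' (R := ℂ) (S := ℂ) a (starRingEnd ℂ a) x (map_mul _ a)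

@[simp]
theorem conjH_surf (M : S.Surf c) : Z.conjH (Z.surf M) = Z.surf (S.conj M) := by
  have h : Finsupp.mapRange (starRingEnd ℂ) (map_zero _) (Finsupp.single M (1 : ℂ)) =
      Finsupp.single M (1 : ℂ) := by simp
  exact (congrArg _ h).trans (Z.lin_surf _ M)

theorem PreH.exists_sum (x : Z.PreH c) : ∃ (n : ℕ) (γ : Fin n → ℂ) (N : Fin n → S.Surf c),
    x = ∑ I, γ I • Z.surf (N I) := by
  induction x using PreH.induction with
  | h0 => exact ⟨0, Fin.elim0, Fin.elim0, by simp⟩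
  | hadd x y hx hy =>
    obtain ⟨n, γ, N, rfl⟩ := hx
    obtain ⟨m, δ, M, rfl⟩ := hy
    exact ⟨n + m, Fin.append γ δ, Fin.append N M, by simp [Fin.sum_univ_add]⟩
  | hsurf a N => exact ⟨1, fun _ => a, fun _ => N, by simp⟩

/-- The bilinear extension to `H_𝓑` of `(M, N) ↦ ζ(M N)`, where `M`, `N` are sewn along `𝓑`. -/
def pairH : Z.PreH c →ₗ[ℂ] Z.PreH c →ₗ[ℂ] ℂ :=
  Z.lin fun M => Z.lin fun N => Z.ζ (pairing M N)

@[simp]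
theorem pairH_surf (M N : S.Surf c) : Z.pairH (Z.surf M) (Z.surf N) = Z.ζ (pairing M N) := by
  simp [pairH]

/-- The pre-inner product `⟨x|y⟩`, antilinear in `x` and linear in `y`, with
`⟨M|N⟩ = ζ(M* N)` for surfaces `M`, `N`. -/
def form (x y : Z.PreH c) : ℂ := Z.pairH (Z.conjH x) y

theorem form_add_right (x y z : Z.PreH c) : Z.form x (y + z) = Z.form x y + Z.form x z := by
  simp [form]

theorem form_smul_right (a : ℂ) (x y : Z.PreH c) : Z.form x (a • y) = a * Z.form x y := by
  simp [form]

theorem form_add_left (x y z : Z.PreH c) : Z.form (x + y) z = Z.form x z + Z.form y z := by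
  simp [form]

theorem form_smul_left (a : ℂ) (x y : Z.PreH c) :
    Z.form (a • x) y = (starRingEnd ℂ) a * Z.form x y := by
  simp [form]

@[simp]
theorem form_surf (M N : S.Surf c) :
    Z.form (Z.surf M) (Z.surf N) = Z.ζ (pairing (S.conj M) N) := by
  simp [form]

theorem form_conj (x y : Z.PreH c) : (starRingEnd ℂ) (Z.form y x) = Z.form x y := by
  induction x using PreH.induction with
  | h0 => simp [form]
  | hadd x x' h h' => rw [form_add_right, form_add_left, map_add, h, h']
  | hsurf a M =>
    rw [form_smul_right, form_smul_left, map_mul]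
    congr 1
    induction y using PreH.induction with
    | h0 => simp [form]
    | hadd x x' h h' => rw [form_add_right, form_add_left, map_add, h, h']
    | hsurf b N =>
      rw [form_smul_right, form_smul_left, map_mul, Complex.conj_conj, form_surf, form_surf,
        ← Z.reality, conj_pairing, S.conj_conj, pairing_comm]

theorem form_sum_right {n : ℕ} (x : Z.PreH c) (f : Fin n → Z.PreH c) :
    Z.form x (∑ i, f i) = ∑ i, Z.form x (f i) := by
  simp [form]

theorem form_self_nonneg (x : Z.PreH c) : 0 ≤ Z.form x x := by
  obtain ⟨n, γ, N, rfl⟩ := PreH.exists_sum Z x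
  have h := Z.reflection_positivity c n γ N
  convert h using 1
  have hl : ∀ y : Z.PreH c, Z.form (∑ I, γ I • Z.surf (N I)) y =
      ∑ I, (starRingEnd ℂ) (γ I) * Z.form (Z.surf (N I)) y := by
    intro y
    rw [← form_conj, form_sum_right, map_sum]
    refine Finset.sum_congr rfl fun I _ => ?_
    rw [form_conj, form_smul_left]
  rw [hl]
  refine Finset.sum_congr rfl fun I _ => ?_
  rw [form_sum_right, Finset.mul_sum]
  refine Finset.sum_congr rfl fun J _ => ?_
  rw [form_smul_right, form_surf]; ring

/-- The pre-inner product of `H_𝓑`. -/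
abbrev core (c : ι → S.Bdry) : PreInnerProductSpace.Core ℂ (Z.PreH c) where
  inner := Z.form
  conj_inner_symm := Z.form_conj
  re_inner_nonneg x := (Complex.le_def.1 (Z.form_self_nonneg x)).1
  add_left := Z.form_add_left
  smul_left x y a := Z.form_smul_left a x y

variable (c)

instance : SeminormedAddCommGroup (Z.PreH c) :=
  InnerProductSpace.Core.toSeminormedAddCommGroup (c := Z.core c)

instance : InnerProductSpace ℂ (Z.PreH c) := InnerProductSpace.ofCore (Z.core c)

variable {c}

theorem inner_surf (M N : S.Surf c) :
    ⟪Z.surf M, Z.surf N⟫_ℂ = Z.ζ (pairing (S.conj M) N) := Z.form_surf M N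

variable (c)

/-- `𝒟_𝓑 = H_𝓑 / 𝒩_𝓑`: the quotient of `H_𝓑` by its null vectors. -/
def D : Type v := SeparationQuotient (Z.PreH c)

instance : NormedAddCommGroup (Z.D c) :=
  inferInstanceAs (NormedAddCommGroup (SeparationQuotient (Z.PreH c)))

instance : InnerProductSpace ℂ (Z.D c) :=
  inferInstanceAs (InnerProductSpace ℂ (SeparationQuotient (Z.PreH c)))

/-- The Hilbert space `𝓗_𝓑`: the completion of `𝒟_𝓑`. -/
def Hilb : Type v := UniformSpace.Completion (Z.D c)

instance : NormedAddCommGroup (Z.Hilb c) :=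
  inferInstanceAs (NormedAddCommGroup (UniformSpace.Completion (Z.D c)))

instance : InnerProductSpace ℂ (Z.Hilb c) :=
  inferInstanceAs (InnerProductSpace ℂ (UniformSpace.Completion (Z.D c)))

instance : CompleteSpace (Z.Hilb c) :=
  inferInstanceAs (CompleteSpace (UniformSpace.Completion (Z.D c)))

variable {c}

/-- The quotient map `H_𝓑 → 𝒟_𝓑`. -/
def toD : Z.PreH c →ₗ[ℂ] Z.D c := (SeparationQuotient.mkCLM ℂ (Z.PreH c)).toLinearMap

/-- The inclusion of the dense subspace `𝒟_𝓑 ⊆ 𝓗_𝓑`. -/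
def toHilb : Z.D c →ₗᵢ[ℂ] Z.Hilb c := UniformSpace.Completion.toComplₗᵢ

theorem toD_surjective : Function.Surjective (Z.toD (c := c)) := SeparationQuotient.surjective_mk

theorem denseRange_toHilb : DenseRange (Z.toHilb (c := c)) :=
  UniformSpace.Completion.denseRange_coe

/-- `|x⟩ ∈ 𝓗_𝓑` for `x ∈ H_𝓑`. -/
def ket : Z.PreH c →ₗ[ℂ] Z.Hilb c := Z.toHilb.toLinearMap ∘ₗ Z.toD

theorem ket_eq (x : Z.PreH c) : Z.ket x = Z.toHilb (Z.toD x) := rfl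

@[simp]
theorem norm_ket (x : Z.PreH c) : ‖Z.ket x‖ = ‖x‖ := by
  rw [ket_eq, LinearIsometry.norm_map]
  exact SeparationQuotient.norm_mk x

@[simp]
theorem inner_ket (x y : Z.PreH c) : ⟪Z.ket x, Z.ket y⟫_ℂ = ⟪x, y⟫_ℂ := by
  rw [ket_eq, ket_eq, LinearIsometry.inner_map_map]
  exact SeparationQuotient.inner_mk_mk x y

theorem denseRange_ket : DenseRange (Z.ket (c := c)) :=
  Z.denseRange_toHilb.comp Z.toD_surjective.denseRange Z.toHilb.continuous

end PreH

section Ops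

variable {B₁ B₂ B₃ B₄ : S.Bdry}

/-- The bilinear extension of the product of surfaces. -/
def mul : Z.PreH ![B₁, B₂] →ₗ[ℂ] Z.PreH ![B₂, B₃] →ₗ[ℂ] Z.PreH ![B₁, B₃] :=
  Z.lin fun M => Z.lin fun N => Z.surf (prod M N)

@[simp]
theorem mul_surf (M : S.Surf ![B₁, B₂]) (N : S.Surf ![B₂, B₃]) :
    Z.mul (Z.surf M) (Z.surf N) = Z.surf (prod M N) := by
  simp [mul]

theorem mul_assoc' (x : Z.PreH ![B₁, B₂]) (y : Z.PreH ![B₂, B₃]) (z : Z.PreH ![B₃, B₄]) :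
    Z.mul (Z.mul x y) z = Z.mul x (Z.mul y z) := by
  induction x using PreH.induction with
  | h0 => simp
  | hadd x x' h h' => simp [h, h']
  | hsurf a M =>
    simp only [map_smul, LinearMap.smul_apply]
    congr 1
    induction y using PreH.induction with
    | h0 => simp
    | hadd x x' h h' => simp only [map_add, LinearMap.add_apply, h, h']
    | hsurf b N =>
      simp only [map_smul, LinearMap.smul_apply]
      congr 1
      induction z using PreH.induction with
      | h0 => simp
      | hadd x x' h h' => simp only [map_add, h, h']
      | hsurf b P => simp [prod_assoc]


theorem conjH_conjH {ι : Type} [Finite ι] {c : ι → S.Bdry} (x : Z.PreH c) :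
    Z.conjH (Z.conjH x) = x := by
  induction x using PreH.induction with
  | h0 => simp
  | hadd x y h h' => simp only [map_add, h, h']
  | hsurf a M => simp [S.conj_conj]

theorem inner_def {ι : Type} [Finite ι] {c : ι → S.Bdry} (x y : Z.PreH c) :
    ⟪x, y⟫_ℂ = Z.pairH (Z.conjH x) y := rfl

theorem conjH_mul (x : Z.PreH ![B₁, B₂]) (y : Z.PreH ![B₂, B₃]) :
    Z.conjH (Z.mul x y) = Z.mul (Z.conjH x) (Z.conjH y) := by
  induction x using PreH.induction with
  | h0 => simp
  | hadd x x' h h' => simp only [map_add, LinearMap.add_apply, h, h']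
  | hsurf a M =>
    simp only [map_smulₛₗ, LinearMap.smul_apply]
    congr 1
    induction y using PreH.induction with
    | h0 => simp
    | hadd x x' h h' => simp only [map_add, h, h']
    | hsurf b N => simp [conj_prod]

/-- The bilinear extension of the disjoint union. -/
def unionH {ι κ : Type} [Finite ι] [Finite κ] {c : ι → S.Bdry} {d : κ → S.Bdry} :
    Z.PreH c →ₗ[ℂ] Z.PreH d →ₗ[ℂ] Z.PreH (Sum.elim c d) :=
  Z.lin fun M => Z.lin fun N => Z.surf (S.union M N)

@[simp]
theorem unionH_surf {ι κ : Type} [Finite ι] [Finite κ] {c : ι → S.Bdry} {d : κ → S.Bdry}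
    (M : S.Surf c) (N : S.Surf d) :
    Z.unionH (Z.surf M) (Z.surf N) = Z.surf (S.union M N) := by
  simp [unionH]

/-- The linear extension of a sewing. -/
def sewH {ι κ : Type} [Finite ι] [Finite κ] {c : ι → S.Bdry} {d : κ → S.Bdry} (T : Sewing c d) :
    Z.PreH c →ₗ[ℂ] Z.PreH d := Z.lin fun M => Z.surf (S.sew T M)

@[simp]
theorem sewH_surf {ι κ : Type} [Finite ι] [Finite κ] {c : ι → S.Bdry} {d : κ → S.Bdry}
    (T : Sewing c d) (M : S.Surf c) : Z.sewH T (Z.surf M) = Z.surf (S.sew T M) := by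
  simp [sewH]

theorem conjH_unionH {ι κ : Type} [Finite ι] [Finite κ] {c : ι → S.Bdry} {d : κ → S.Bdry}
    (x : Z.PreH c) (y : Z.PreH d) :
    Z.conjH (Z.unionH x y) = Z.unionH (Z.conjH x) (Z.conjH y) := by
  induction x using PreH.induction with
  | h0 => simp
  | hadd x x' h h' => simp only [map_add, LinearMap.add_apply, h, h']
  | hsurf a M =>
    simp only [map_smulₛₗ, LinearMap.smul_apply]
    congr 1
    induction y using PreH.induction with
    | h0 => simp
    | hadd x x' h h' => simp only [map_add, h, h']
    | hsurf b N => simp [S.conj_union]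

theorem conjH_sewH {ι κ : Type} [Finite ι] [Finite κ] {c : ι → S.Bdry} {d : κ → S.Bdry}
    (T : Sewing c d) (x : Z.PreH c) : Z.conjH (Z.sewH T x) = Z.sewH T (Z.conjH x) := by
  induction x using PreH.induction with
  | h0 => simp
  | hadd x x' h h' => simp only [map_add, h, h']
  | hsurf a M => simp [S.conj_sew]

theorem pairH_comm {ι : Type} [Finite ι] {c : ι → S.Bdry} (x y : Z.PreH c) :
    Z.pairH x y = Z.pairH y x := by
  induction x using PreH.induction with
  | h0 => simp
  | hadd x x' h h' => simp only [map_add, LinearMap.add_apply, h, h']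
  | hsurf a M =>
    simp only [map_smul, LinearMap.smul_apply]
    congr 1
    induction y using PreH.induction with
    | h0 => simp
    | hadd x x' h h' => simp only [map_add, LinearMap.add_apply, h, h']
    | hsurf b N => simp [pairing_comm M N]

theorem pairH_unionH {ι κ : Type} [Finite ι] [Finite κ] {c : ι → S.Bdry} {d : κ → S.Bdry}
    (x x' : Z.PreH c) (y y' : Z.PreH d) :
    Z.pairH (Z.unionH x y) (Z.unionH x' y') = Z.pairH x x' * Z.pairH y y' := by
  induction x using PreH.induction with
  | h0 => simp
  | hadd u v h h' => simp only [map_add, LinearMap.add_apply, h, h', add_mul]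
  | hsurf a M =>
    simp only [map_smul, LinearMap.smul_apply, smul_eq_mul, mul_assoc]
    congr 1
    induction y using PreH.induction with
    | h0 => simp
    | hadd u v h h' => simp only [map_add, LinearMap.add_apply, h, h', mul_add]
    | hsurf b N =>
      simp only [map_smul, LinearMap.smul_apply, smul_eq_mul, mul_left_comm _ b]
      congr 1
      induction x' using PreH.induction with
      | h0 => simp
      | hadd u v h h' => simp only [map_add, LinearMap.add_apply, h, h', add_mul]
      | hsurf a M' =>
        simp only [map_smul, LinearMap.smul_apply, smul_eq_mul, mul_assoc]
        congr 1
        induction y' using PreH.induction with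
        | h0 => simp
        | hadd u v h h' => simp only [map_add, h, h', mul_add]
        | hsurf b N' =>
          simp only [map_smul, smul_eq_mul, mul_left_comm _ b]
          congr 1
          simp [pairing_union, Z.factorization]

theorem pairH_rename {ι κ : Type} [Finite ι] [Finite κ] {c : ι → S.Bdry} {d : κ → S.Bdry}
    (f : κ ≃ ι) (hf : ∀ k, c (f k) = d k) (x y : Z.PreH c) :
    Z.pairH (Z.sewH (Sewing.rename f hf) x) (Z.sewH (Sewing.rename f hf) y) = Z.pairH x y := by
  induction x using PreH.induction with
  | h0 => simp
  | hadd x x' h h' => simp only [map_add, LinearMap.add_apply, h, h']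
  | hsurf a M =>
    simp only [map_smul, LinearMap.smul_apply]
    congr 1
    induction y using PreH.induction with
    | h0 => simp
    | hadd x x' h h' => simp only [map_add, h, h']
    | hsurf b N => simp [pairing_rename]

/-- The linear extension of `swapMid`. -/
def swapH : Z.PreH (Sum.elim ![B₁, B₂] ![B₂, B₃]) →ₗ[ℂ] Z.PreH (Sum.elim ![B₁, B₂] ![B₂, B₃]) :=
  Z.sewH (Sewing.rename (Equiv.swap (Sum.inl 1) (Sum.inr 0)) color_swapMid)

theorem swapH_surf (M : S.Surf (Sum.elim ![B₁, B₂] ![B₂, B₃])) :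
    Z.swapH (Z.surf M) = Z.surf (swapMid M) := Z.sewH_surf _ M

theorem pairH_mul_mul (x x' : Z.PreH ![B₁, B₂]) (y y' : Z.PreH ![B₂, B₃]) :
    Z.pairH (Z.mul x y) (Z.mul x' y') = Z.pairH (Z.unionH x y') (Z.swapH (Z.unionH x' y)) := by
  induction x using PreH.induction with
  | h0 => simp
  | hadd u v h h' => simp only [map_add, LinearMap.add_apply, h, h']
  | hsurf a M =>
    simp only [map_smul, LinearMap.smul_apply]
    congr 1
    induction y using PreH.induction with
    | h0 => simp
    | hadd u v h h' => simp only [map_add, LinearMap.add_apply, h, h']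
    | hsurf b N =>
      simp only [map_smul, LinearMap.smul_apply]
      congr 1
      induction x' using PreH.induction with
      | h0 => simp
      | hadd u v h h' => simp only [map_add, LinearMap.add_apply, h, h']
      | hsurf a M' =>
        simp only [map_smul, LinearMap.smul_apply]
        congr 1
        induction y' using PreH.induction with
        | h0 => simp
        | hadd u v h h' => simp only [map_add, LinearMap.add_apply, h, h']
        | hsurf b N' =>
          simp only [map_smul, LinearMap.smul_apply]
          congr 1
          simp only [mul_surf, unionH_surf, swapH_surf, pairH_surf, pairing_prod_prod]

theorem norm_swapH (x : Z.PreH (Sum.elim ![B₁, B₂] ![B₂, B₃])) : ‖Z.swapH x‖ = ‖x‖ := by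
  have h : ⟪Z.swapH x, Z.swapH x⟫_ℂ = ⟪x, x⟫_ℂ := by
    rw [inner_def, inner_def, swapH, conjH_sewH, pairH_rename]
  rw [@norm_eq_sqrt_re_inner ℂ, @norm_eq_sqrt_re_inner ℂ _ _ _ _ x, h]

theorem norm_unionH {ι κ : Type} [Finite ι] [Finite κ] {c : ι → S.Bdry} {d : κ → S.Bdry}
    (x : Z.PreH c) (y : Z.PreH d) : ‖Z.unionH x y‖ = ‖x‖ * ‖y‖ := by
  have h : ⟪Z.unionH x y, Z.unionH x y⟫_ℂ = ⟪x, x⟫_ℂ * ⟪y, y⟫_ℂ := by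
    rw [inner_def, inner_def, inner_def, conjH_unionH, pairH_unionH]
  rw [inner_self_eq_norm_sq_to_K, inner_self_eq_norm_sq_to_K, inner_self_eq_norm_sq_to_K,
    ← mul_pow] at h
  refine (pow_left_inj₀ (norm_nonneg _) (by positivity) two_ne_zero).1 ?_
  exact_mod_cast h

theorem norm_conjH {ι : Type} [Finite ι] {c : ι → S.Bdry} (x : Z.PreH c) :
    ‖Z.conjH x‖ = ‖x‖ := by
  have h : ⟪Z.conjH x, Z.conjH x⟫_ℂ = ⟪x, x⟫_ℂ := by
    rw [inner_def, inner_def, conjH_conjH, pairH_comm]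
  rw [@norm_eq_sqrt_re_inner ℂ, @norm_eq_sqrt_re_inner ℂ _ _ _ _ x, h]

/-- The trace inequality `tr(y⋆ x⋆ x y) ≤ tr(x⋆ x) tr(y⋆ y)`. -/
theorem norm_mul_le (x : Z.PreH ![B₁, B₂]) (y : Z.PreH ![B₂, B₃]) :
    ‖Z.mul x y‖ ≤ ‖x‖ * ‖y‖ := by
  have h : ⟪Z.mul x y, Z.mul x y⟫_ℂ =
      ⟪Z.unionH x (Z.conjH y), Z.swapH (Z.unionH x (Z.conjH y))⟫_ℂ := by
    rw [inner_def, inner_def, conjH_mul, pairH_mul_mul, conjH_unionH, conjH_conjH]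
  have h' : ‖Z.mul x y‖ ^ 2 ≤ (‖x‖ * ‖y‖) ^ 2 := by
    have h1 := norm_inner_le_norm (𝕜 := ℂ) (Z.unionH x (Z.conjH y))
      (Z.swapH (Z.unionH x (Z.conjH y)))
    rw [← h, norm_swapH, norm_unionH, norm_conjH, inner_self_eq_norm_sq_to_K] at h1
    simpa [pow_two] using h1
  exact le_of_sq_le_sq h' (by positivity)

/-- The antilinear extension of the involution `⋆`. -/
def starH (x : Z.PreH ![B₁, B₂]) : Z.PreH ![B₂, B₁] := Z.conjH (Z.sewH (Sewing.flip B₁ B₂) x)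

theorem pairH_mul_right (z : Z.PreH ![B₁, B₃]) (x : Z.PreH ![B₁, B₂]) (y : Z.PreH ![B₂, B₃]) :
    Z.pairH z (Z.mul x y) = Z.pairH (Z.mul z (Z.sewH (Sewing.flip B₂ B₃) y)) x := by
  induction z using PreH.induction with
  | h0 => simp
  | hadd u v h h' => simp only [map_add, LinearMap.add_apply, h, h']
  | hsurf a M =>
    simp only [map_smul, LinearMap.smul_apply]
    congr 1
    induction y using PreH.induction with
    | h0 => simp
    | hadd u v h h' => simp only [map_add, LinearMap.add_apply, h, h']
    | hsurf b N =>
      simp only [map_smul, LinearMap.smul_apply]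
      congr 1
      induction x using PreH.induction with
      | h0 => simp
      | hadd u v h h' => simp only [map_add, LinearMap.add_apply, h, h']
      | hsurf a M' =>
        simp only [map_smul, LinearMap.smul_apply]
        congr 1
        simp [pairing_prod_right]

theorem inner_mul_right (z : Z.PreH ![B₁, B₃]) (x : Z.PreH ![B₁, B₂]) (y : Z.PreH ![B₂, B₃]) :
    ⟪z, Z.mul x y⟫_ℂ = ⟪Z.mul z (Z.starH y), x⟫_ℂ := by
  rw [inner_def, inner_def, pairH_mul_right, conjH_mul, starH, conjH_conjH]

end Ops

theorem norm_le_of_commute {H K : Type*} [NormedAddCommGroup H] [InnerProductSpace ℂ H]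
    [CompleteSpace H] [NormedAddCommGroup K] [InnerProductSpace ℂ K] (R : H →L[ℂ] K) (T : H →L[ℂ] H)
    (hTR : ∀ x y, ⟪R x, R y⟫_ℂ = ⟪T x, y⟫_ℂ) (a : H →L[ℂ] H) (hcomm : Commute T a) (x : H) :
    ‖R (a x)‖ ≤ ‖a‖ * ‖R x‖ := by
  have hpos : 0 ≤ T := by
    rw [ContinuousLinearMap.nonneg_iff_isPositive, ContinuousLinearMap.isPositive_iff_complex]
    intro x
    rw [← hTR, inner_self_eq_norm_sq_to_K]
    exact ⟨by norm_cast, by norm_cast; positivity⟩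
  let Q := CFC.sqrt T
  have hQpos : 0 ≤ Q := CFC.sqrt_nonneg T
  have hQsa : IsSelfAdjoint Q := IsSelfAdjoint.of_nonneg hQpos
  have hQQ : Q * Q = T := CFC.sqrt_mul_sqrt_self T hpos
  have hQcomm : Commute Q a := hcomm.cfcₙ_nnreal NNReal.sqrt
  have hnorm : ∀ x, ‖R x‖ = ‖Q x‖ := by
    intro x
    have h : ⟪R x, R x⟫_ℂ = ⟪Q x, Q x⟫_ℂ := by
      rw [hTR, ← hQQ, ← ContinuousLinearMap.adjoint_inner_right,
        ← ContinuousLinearMap.star_eq_adjoint, star_mul, hQsa.star_eq]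
      change ⟪x, Q (Q x)⟫_ℂ = _
      rw [← ContinuousLinearMap.adjoint_inner_left, ← ContinuousLinearMap.star_eq_adjoint,
        hQsa.star_eq]
    rw [@norm_eq_sqrt_re_inner ℂ, @norm_eq_sqrt_re_inner ℂ _ _ _ _ (Q x), h]
  rw [hnorm, hnorm]
  have : Q (a x) = a (Q x) := congrArg (fun F => F x) hQcomm
  rw [this]
  exact a.le_opNorm _

section Operators

variable {B₁ B₂ B₃ : S.Bdry}

/-- `â_R : 𝓗_{B₁ ⊔ B₂} → 𝓗_{B₁ ⊔ B₃}`, `|φ⟩ ↦ |φ a⟩`: sewing `a ∈ H_{B₂ ⊔ B₃}` to the right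
boundary. This is the bounded extension of the operator defined on the dense subspace. -/
def rightOp (B₁ : S.Bdry) (a : Z.PreH ![B₂, B₃]) :
    Z.Hilb ![B₁, B₂] →L[ℂ] Z.Hilb ![B₁, B₃] :=
  (Z.ket ∘ₗ Z.mul.flip a).extendOfNorm Z.ket

/-- `â_L : 𝓗_{B₂ ⊔ B₃} → 𝓗_{B₁ ⊔ B₃}`, `|φ⟩ ↦ |a φ⟩`: sewing `a ∈ H_{B₁ ⊔ B₂}` to the left
boundary. This is the bounded extension of the operator defined on the dense subspace. -/
def leftOp (B₃ : S.Bdry) (a : Z.PreH ![B₁, B₂]) :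
    Z.Hilb ![B₂, B₃] →L[ℂ] Z.Hilb ![B₁, B₃] :=
  (Z.ket ∘ₗ Z.mul a).extendOfNorm Z.ket

@[simp]
theorem rightOp_ket (a : Z.PreH ![B₂, B₃]) (φ : Z.PreH ![B₁, B₂]) :
    Z.rightOp B₁ a (Z.ket φ) = Z.ket (Z.mul φ a) :=
  LinearMap.extendOfNorm_eq Z.denseRange_ket
    ⟨‖a‖, fun x => by simpa [mul_comm] using Z.norm_mul_le x a⟩ φ

@[simp]
theorem leftOp_ket (a : Z.PreH ![B₁, B₂]) (φ : Z.PreH ![B₂, B₃]) :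
    Z.leftOp B₃ a (Z.ket φ) = Z.ket (Z.mul a φ) :=
  LinearMap.extendOfNorm_eq Z.denseRange_ket
    ⟨‖a‖, fun x => by simpa using Z.norm_mul_le a x⟩ φ

theorem ext_ket {ι : Type} [Finite ι] {c : ι → S.Bdry} {V : Type*} [TopologicalSpace V] [T2Space V]
    {f g : Z.Hilb c → V} (hf : Continuous f) (hg : Continuous g)
    (h : ∀ x, f (Z.ket x) = g (Z.ket x)) : f = g :=
  Z.denseRange_ket.equalizer hf hg (funext h)

theorem rightOp_congr {a b : Z.PreH ![B₂, B₃]} (h : Inseparable a b) :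
    Z.rightOp B₁ a = Z.rightOp B₁ b := by
  refine DFunLike.coe_injective (Z.ext_ket (Z.rightOp B₁ a).continuous
    (Z.rightOp B₁ b).continuous fun φ => ?_)
  rw [rightOp_ket, rightOp_ket, ← sub_eq_zero, ← map_sub, ← map_sub, ← norm_le_zero_iff, norm_ket]
  refine (Z.norm_mul_le _ _).trans ?_
  rw [← dist_eq_norm, Metric.inseparable_iff.1 h, mul_zero]

theorem rightOp_add (a b : Z.PreH ![B₂, B₃]) :
    Z.rightOp B₁ (a + b) = Z.rightOp B₁ a + Z.rightOp B₁ b := by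
  refine DFunLike.coe_injective (Z.ext_ket (Z.rightOp B₁ (a + b)).continuous
    (Z.rightOp B₁ a + Z.rightOp B₁ b).continuous fun φ => ?_)
  simp

theorem rightOp_smul (t : ℂ) (a : Z.PreH ![B₂, B₃]) :
    Z.rightOp B₁ (t • a) = t • Z.rightOp B₁ a := by
  refine DFunLike.coe_injective (Z.ext_ket (Z.rightOp B₁ (t • a)).continuous
    (t • Z.rightOp B₁ a).continuous fun φ => ?_)
  simp

/-- `Ψ_R : 𝒟_LR → 𝓑(𝓗_LL, 𝓗_LR)`, `|a⟩ ↦ â_R`. -/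
def PsiR (BL BR : S.Bdry) :
    Z.D ![BL, BR] →ₗ[ℂ] (Z.Hilb ![BL, BL] →L[ℂ] Z.Hilb ![BL, BR]) where
  toFun := SeparationQuotient.lift (Z.rightOp BL) fun _ _ h => Z.rightOp_congr h
  map_add' := Quotient.ind₂ fun a b => Z.rightOp_add a b
  map_smul' t := Quotient.ind fun a => Z.rightOp_smul t a

theorem PsiR_toD {BL BR : S.Bdry} (a : Z.PreH ![BL, BR]) :
    Z.PsiR BL BR (Z.toD a) = Z.rightOp BL a := rfl

/-- The von Neumann algebra `𝒜_L^{LR}`: the closure in the weak operator topology on `𝓑(𝓗_LR)` of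
the representation `Â_L^{LR} = {â_L | a ∈ A_L}` of the left surface algebra `A_L = H_LL`. -/
def leftAlgebra (BL BR : S.Bdry) : Set (Z.Hilb ![BL, BR] →L[ℂ] Z.Hilb ![BL, BR]) :=
  {T | ContinuousLinearMapWOT.ofCLM T ∈
    closure (ContinuousLinearMapWOT.ofCLM '' Set.range fun a : Z.PreH ![BL, BL] => Z.leftOp BR a)}

/-- The cylinder `C_ε` as an element of `H_{B ⊔ B}`. -/
def cyl (B : S.Bdry) (ε : ℝ) : Z.PreH ![B, B] := Z.surf (S.cyl B ε)

/-- The operator `|ψ⟩ ↦ ψ̂^ε_R a |C_ε⟩` before completion: each surface `N` is written in some way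
as `N = C_ε N^ε` and sent to `(N^ε)^_R a |C_ε⟩`. -/
def PhiPre {BL : S.Bdry} (BR : S.Bdry) (a : Z.Hilb ![BL, BL] →L[ℂ] Z.Hilb ![BL, BL]) :
    Z.PreH ![BL, BR] →ₗ[ℂ] Z.Hilb ![BL, BR] :=
  Z.lin fun N =>
    Z.rightOp BL (Z.surf (S.rim_left N).choose_spec.2.choose)
      (a (Z.ket (Z.cyl BL (S.rim_left N).choose)))

/-- `Φ_LR(a)` for `a ∈ 𝒜_L^{LL}`: the bounded operator on `𝓗_LR` with
`Φ_LR(a) |C_ε φ⟩ = φ̂_R a |C_ε⟩` for all `ε > 0`, `φ ∈ H_LR`; see `Phi_ket`. -/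
def Phi {BL : S.Bdry} (BR : S.Bdry) (a : Z.leftAlgebra BL BL) :
    Z.Hilb ![BL, BR] →L[ℂ] Z.Hilb ![BL, BR] :=
  (Z.PhiPre BR a.1).extendOfNorm Z.ket

theorem leftAlgebra_induction {BL BR : S.Bdry}
    {p : (Z.Hilb ![BL, BR] →L[ℂ] Z.Hilb ![BL, BR]) → Prop}
    (hp : IsClosed {T : Z.Hilb ![BL, BR] →WOT[ℂ] Z.Hilb ![BL, BR] | p T.toCLM})
    (h : ∀ x, p (Z.leftOp BR x)) (a : Z.leftAlgebra BL BR) : p a.1 := by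
  have : closure (ContinuousLinearMapWOT.ofCLM '' Set.range fun a : Z.PreH ![BL, BL] =>
      Z.leftOp BR a) ⊆ {T : Z.Hilb ![BL, BR] →WOT[ℂ] Z.Hilb ![BL, BR] | p T.toCLM} := by
    refine hp.closure_subset_iff.2 ?_
    rintro _ ⟨_, ⟨x, rfl⟩, rfl⟩
    exact h x
  exact this a.2

/-- Independence of the choice of `ε`. -/
theorem Phi_indep {BL BR : S.Bdry} (a : Z.leftAlgebra BL BL) {C C' : Z.PreH ![BL, BL]}
    {φ φ' : Z.PreH ![BL, BR]} (h : Z.mul C φ = Z.mul C' φ') :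
    Z.rightOp BL φ (a.1 (Z.ket C)) = Z.rightOp BL φ' (a.1 (Z.ket C')) := by
  refine ext_inner_left ℂ fun v => ?_
  revert a
  refine Z.leftAlgebra_induction (p := fun a => ⟪v, Z.rightOp BL φ (a (Z.ket C))⟫_ℂ =
    ⟪v, Z.rightOp BL φ' (a (Z.ket C'))⟫_ℂ) ?_ ?_
  · refine isClosed_eq ?_ ?_
    · exact ContinuousLinearMapWOT.continuous_dual_apply (Z.ket C)
        ((innerSL ℂ v).comp (Z.rightOp BL φ))
    · exact ContinuousLinearMapWOT.continuous_dual_apply (Z.ket C')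
        ((innerSL ℂ v).comp (Z.rightOp BL φ'))
  · intro x
    rw [leftOp_ket, leftOp_ket, rightOp_ket, rightOp_ket, mul_assoc', mul_assoc', h]

theorem inner_rightOp (φ : Z.PreH ![B₂, B₃]) (x : Z.Hilb ![B₁, B₂]) (y : Z.Hilb ![B₁, B₃]) :
    ⟪y, Z.rightOp B₁ φ x⟫_ℂ = ⟪Z.rightOp B₁ (Z.starH φ) y, x⟫_ℂ := by
  revert x
  refine congrFun (Z.ext_ket (by fun_prop) (by fun_prop) fun x => ?_)
  revert y
  refine congrFun (Z.ext_ket (by fun_prop) (by fun_prop) fun y => ?_)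
  rw [rightOp_ket, rightOp_ket, inner_ket, inner_ket, inner_mul_right]

/-- Elements of the left von Neumann algebra commute with right operators. -/
theorem leftAlgebra_commute {BL : S.Bdry} (a : Z.leftAlgebra BL BL) (φ : Z.PreH ![BL, BL])
    (x : Z.Hilb ![BL, BL]) : Z.rightOp BL φ (a.1 x) = a.1 (Z.rightOp BL φ x) := by
  refine ext_inner_left ℂ fun v => ?_
  revert a
  refine Z.leftAlgebra_induction (p := fun a => ⟪v, Z.rightOp BL φ (a x)⟫_ℂ =
    ⟪v, a (Z.rightOp BL φ x)⟫_ℂ) ?_ ?_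
  · refine isClosed_eq ?_ ?_
    · exact ContinuousLinearMapWOT.continuous_dual_apply x
        ((innerSL ℂ v).comp (Z.rightOp BL φ))
    · exact ContinuousLinearMapWOT.continuous_dual_apply _ (innerSL ℂ v)
  · intro y
    congr 1
    revert x
    refine congrFun (Z.ext_ket (by fun_prop) (by fun_prop) fun x => ?_)
    rw [leftOp_ket, rightOp_ket, rightOp_ket, leftOp_ket, mul_assoc']

theorem Phi_bound {BL BR : S.Bdry} (a : Z.leftAlgebra BL BL) (φ : Z.PreH ![BL, BR])
    (x : Z.Hilb ![BL, BL]) :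
    ‖Z.rightOp BL φ (a.1 x)‖ ≤ ‖a.1‖ * ‖Z.rightOp BL φ x‖ := by
  set R : Z.Hilb ![BL, BL] →L[ℂ] Z.Hilb ![BL, BR] := Z.rightOp BL φ with hR
  set T : Z.Hilb ![BL, BL] →L[ℂ] Z.Hilb ![BL, BL] := Z.rightOp BL (Z.mul φ (Z.starH φ)) with hT
  have hTR : ∀ x y, ⟪R x, R y⟫_ℂ = ⟪T x, y⟫_ℂ := by
    intro x y
    rw [hR, inner_rightOp]
    congr 1
    revert x
    refine congrFun (Z.ext_ket (by fun_prop) (by fun_prop) fun x => ?_)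
    rw [rightOp_ket, rightOp_ket, rightOp_ket, mul_assoc']
  exact norm_le_of_commute R T hTR a.1
    (ContinuousLinearMap.ext fun x => Z.leftAlgebra_commute a _ x) x

theorem exists_common_rim {BL BR : S.Bdry} (ψ : Z.PreH ![BL, BR]) :
    ∃ ε₀ : ℝ, 0 < ε₀ ∧ ∀ ε, 0 < ε → ε < ε₀ → ∃ φ, ψ = Z.mul (Z.cyl BL ε) φ := by
  induction ψ using PreH.induction with
  | h0 => exact ⟨1, one_pos, fun ε _ _ => ⟨0, by simp⟩⟩
  | hadd x y hx hy =>
    obtain ⟨e, he, h⟩ := hx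
    obtain ⟨e', he', h'⟩ := hy
    refine ⟨min e e', lt_min he he', fun ε hε hlt => ?_⟩
    obtain ⟨φ, rfl⟩ := h ε hε (hlt.trans_le (min_le_left _ _))
    obtain ⟨φ', rfl⟩ := h' ε hε (hlt.trans_le (min_le_right _ _))
    exact ⟨φ + φ', by simp⟩
  | hsurf t N =>
    obtain ⟨e, he, N', hN⟩ := S.rim_left N
    refine ⟨e, he, fun ε hε hlt => ⟨t • Z.surf (prod (S.cyl BL (e - ε)) N'), ?_⟩⟩
    rw [map_smul, cyl, mul_surf, ← prod_assoc]
    congr 2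
    have := S.cyl_add BL ε (e - ε) hε (by linarith)
    rw [add_sub_cancel] at this
    rw [hN]
    unfold prod
    rw [this]

theorem PhiPre_mul {BL BR : S.Bdry} (a : Z.leftAlgebra BL BL) (C : Z.PreH ![BL, BL])
    (φ : Z.PreH ![BL, BR]) :
    Z.PhiPre BR a.1 (Z.mul C φ) = Z.rightOp BL φ (a.1 (Z.ket C)) := by
  induction φ using PreH.induction with
  | h0 =>
    have : Z.rightOp BL (0 : Z.PreH ![BL, BR]) = 0 :=
      (Z.PsiR BL BR).map_zero
    simp [this]
  | hadd x y hx hy => simp [rightOp_add, hx, hy]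
  | hsurf t M =>
    rw [map_smul, map_smul, rightOp_smul, smul_apply]
    congr 1
    induction C using PreH.induction with
    | h0 => simp
    | hadd x y hx hy => simp [hx, hy]
    | hsurf t N =>
      simp only [map_smul, LinearMap.smul_apply]
      congr 1
      rw [mul_surf, PhiPre, lin_surf]
      apply Phi_indep
      rw [cyl, mul_surf, mul_surf]
      exact congrArg _ (S.rim_left (prod N M)).choose_spec.2.choose_spec.symm

theorem Phi_ket_mul {BL BR : S.Bdry} (a : Z.leftAlgebra BL BL) (C : Z.PreH ![BL, BL])
    (φ : Z.PreH ![BL, BR]) :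
    Z.Phi BR a (Z.ket (Z.mul C φ)) = Z.rightOp BL φ (a.1 (Z.ket C)) := by
  rw [← PhiPre_mul]
  refine LinearMap.extendOfNorm_eq Z.denseRange_ket ⟨‖a.1‖, fun ψ => ?_⟩ _
  obtain ⟨e, he, h⟩ := Z.exists_common_rim ψ
  obtain ⟨φ, rfl⟩ := h (e / 2) (by linarith) (by linarith)
  rw [PhiPre_mul]
  simpa using Z.Phi_bound a φ (Z.ket (Z.cyl BL (e / 2)))

/-- The defining property of `Φ_LR(a)`; it determines `Φ_LR(a)` because every `ψ ∈ H_LR` is of the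
form `C_ε φ` by `exists_common_rim`. -/
theorem Phi_ket {BL BR : S.Bdry} (a : Z.leftAlgebra BL BL) (ε : ℝ) (φ : Z.PreH ![BL, BR]) :
    Z.Phi BR a (Z.ket (Z.mul (Z.cyl BL ε) φ)) = Z.rightOp BL φ (a.1 (Z.ket (Z.cyl BL ε))) :=
  Z.Phi_ket_mul a _ φ

end Operators

/-- Continuity of an operator-valued map `F : X → 𝓑(H, K)` with respect to the strong operator
topology (pointwise convergence in norm) on `𝓑(H, K)`. -/
def StrongContinuous {X H K : Type*} [TopologicalSpace X] [NormedAddCommGroup H]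
    [InnerProductSpace ℂ H] [NormedAddCommGroup K] [InnerProductSpace ℂ K]
    (F : X → (H →L[ℂ] K)) : Prop :=
  Continuous fun x => ContinuousLinearMap.toPointwiseConvergenceCLM ℂ (RingHom.id ℂ) H K (F x)

end PathIntegral

end

/-! The trace inequality `norm_mul_le`, ‖φa‖ ≤ ‖φ‖ ‖a‖, says that â_R has operator norm at most ‖a‖.
So Ψ_R is bounded even for the operator norm, which is more than strong continuity, and it extends
to 𝓗_LR because 𝒟_LR is dense. Any strongly continuous extension agrees with this one, since for
each fixed x both sides are continuous in ψ and coincide on 𝒟_LR.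

For φ ∈ H_LR the intertwining relation Φ(a) φ̂_R = φ̂_R a holds on kets |C⟩ by the defining property
of Φ(a), because φ̂_R|C⟩ = |Cφ⟩ (`Phi_rightOp`). Both sides are continuous in φ, so the relation
passes to every ψ ∈ 𝓗_LR.

The substantial point is that Φ(a) lies in 𝒜_L^{LR}. The operators â_L on 𝓗_LR form a *-algebra. It
need not contain the identity, but it acts nondegenerately since all surfaces are rimmed. By von
Neumann's density theorem it suffices that Φ(a) commutes with every T in the commutant
(`Phi_commute_of_leftOp_commute`). For such T and any φ, χ ∈ H_LR, the operator χ̂_R^* T φ̂_R on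
𝓗_LL commutes with all left operators, hence with a. With the intertwining relations on both sides,
χ̂_R^* T Φ(a) φ̂_R = χ̂_R^* T φ̂_R a = a χ̂_R^* T φ̂_R = χ̂_R^* Φ(a) T φ̂_R. The ranges of the φ̂_R
contain every ket by rimming, so φ̂_R and χ̂_R^* can be cancelled. -/

/-! ### Von Neumann's density theorem for nondegenerate *-algebras -/

section Bicommutant

variable {H ι : Type*} [NormedAddCommGroup H] [InnerProductSpace ℂ H]

/-- The matrix entries of an operator on a Hilbert sum of copies of `H`. -/
noncomputable def entryOp [DecidableEq ι]
    (P : PiLp 2 (fun _ : ι => H) →L[ℂ] PiLp 2 (fun _ : ι => H)) (i j : ι) : H →L[ℂ] H :=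
  PiLp.proj 2 (fun _ : ι => H) i ∘L P ∘L
    ((PiLp.continuousLinearEquiv 2 ℂ fun _ : ι => H).symm :
      (ι → H) →L[ℂ] PiLp 2 (fun _ : ι => H)) ∘L
    ContinuousLinearMap.single ℂ (fun _ : ι => H) j

theorem entryOp_apply [DecidableEq ι]
    (P : PiLp 2 (fun _ : ι => H) →L[ℂ] PiLp 2 (fun _ : ι => H)) (i j : ι) (x : H) :
    entryOp P i j x = P (PiLp.single 2 j x) i := rfl

variable [Fintype ι]

/-- The diagonal operator `(x i) ↦ (A x i)` on a finite Hilbert sum of copies of `H`. -/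
noncomputable def diagOp (ι : Type*) [Fintype ι] (A : H →L[ℂ] H) :
    PiLp 2 (fun _ : ι => H) →L[ℂ] PiLp 2 (fun _ : ι => H) :=
  ((PiLp.continuousLinearEquiv 2 ℂ fun _ : ι => H).symm :
      (ι → H) →L[ℂ] PiLp 2 (fun _ : ι => H)) ∘L
    ContinuousLinearMap.piMap (fun _ => A) ∘L
    ((PiLp.continuousLinearEquiv 2 ℂ fun _ : ι => H) : PiLp 2 (fun _ : ι => H) →L[ℂ] ι → H)

@[simp]
theorem diagOp_apply (A : H →L[ℂ] H) (w : PiLp 2 (fun _ : ι => H)) (i : ι) :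
    diagOp ι A w i = A (w i) := rfl

/-- Adjoints are taken coordinate by coordinate. Adjointness is stated as a relation between two
operators because the density theorem needs the adjoint as a member of the given algebra. -/
theorem inner_diagOp {A A' : H →L[ℂ] H} (h : ∀ x y, ⟪x, A y⟫_ℂ = ⟪A' x, y⟫_ℂ)
    (x y : PiLp 2 (fun _ : ι => H)) : ⟪x, diagOp ι A y⟫_ℂ = ⟪diagOp ι A' x, y⟫_ℂ := by
  simp [PiLp.inner_apply, h]

/-- If `B` commutes with the matrix entries of `P`, then its diagonal amplification commutes
with `P`. -/
theorem diagOp_comm {B : H →L[ℂ] H}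
    {P : PiLp 2 (fun _ : ι => H) →L[ℂ] PiLp 2 (fun _ : ι => H)} [DecidableEq ι]
    (h : ∀ i j x, P (PiLp.single 2 j (B x)) i = B (P (PiLp.single 2 j x) i))
    (w : PiLp 2 (fun _ : ι => H)) : P (diagOp ι B w) = diagOp ι B (P w) := by
  -- Splitting a vector into its coordinate vectors reduces the claim to the matrix entries of `P`.
  have key : ∀ u : PiLp 2 (fun _ : ι => H), u = ∑ j, PiLp.single 2 j (u j) := by
    intro u
    ext i
    simp [Pi.single_apply, -WithLp.toLp_sum]
  ext i
  conv_lhs => rw [key (diagOp ι B w)]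
  conv_rhs => rw [key w]
  simp [h]

variable [CompleteSpace H]

/-- The density theorem behind von Neumann's double commutant theorem. -/
theorem exists_norm_sub_lt_of_commute_commutant (𝒜 : Submodule ℂ (H →L[ℂ] H))
    (hmul : ∀ A ∈ 𝒜, ∀ A' ∈ 𝒜, A.comp A' ∈ 𝒜)
    (hstar : ∀ A ∈ 𝒜, ∃ A' ∈ 𝒜, ∀ x y, ⟪x, A y⟫_ℂ = ⟪A' x, y⟫_ℂ)
    (hnd : ∀ w, (∀ A ∈ 𝒜, A w = 0) → w = 0) {B : H →L[ℂ] H}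
    (hB : ∀ T : H →L[ℂ] H, (∀ A ∈ 𝒜, ∀ x, T (A x) = A (T x)) → ∀ x, T (B x) = B (T x))
    (v : ι → H) {ε : ℝ} (hε : 0 < ε) : ∃ A ∈ 𝒜, ∀ i, ‖A (v i) - B (v i)‖ < ε := by
  classical
  -- Amplification: approximating `B` on the finitely many vectors `v i` at once is approximating
  -- `diagOp ι B` on the single vector `w`.
  let w : PiLp 2 (fun _ : ι => H) := WithLp.toLp 2 v
  let ev : (H →L[ℂ] H) →ₗ[ℂ] PiLp 2 (fun _ : ι => H) :=
    { toFun := fun A => diagOp ι A w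
      map_add' := fun A A' => by ext i; simp
      map_smul' := fun t A => by ext i; simp }
  -- The closure of the orbit 𝒜w. The aim is to show that it contains `diagOp ι B w`.
  let V := (𝒜.map ev).topologicalClosure
  have hV : ∀ A ∈ 𝒜, ∀ u ∈ V, diagOp ι A u ∈ V := by
    intro A hA u hu
    refine map_mem_closure (diagOp ι A).continuous hu ?_
    rintro _ ⟨A', hA', rfl⟩
    exact ⟨A.comp A', hmul A hA A' hA', rfl⟩
  have : CompleteSpace V := (𝒜.map ev).isClosed_topologicalClosure.completeSpace_coe
  let P := V.starProjection
  -- `V` is invariant under 𝒜, and under adjoints of members of 𝒜 because these lie in 𝒜 again. So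
  -- the orthogonal complement of `V` is invariant too, and the projection onto `V` commutes with 𝒜.
  have hP : ∀ A ∈ 𝒜, ∀ u, P (diagOp ι A u) = diagOp ι A (P u) := by
    intro A hA u
    refine (Submodule.eq_starProjection_of_mem_orthogonal
      (hV A hA _ (V.starProjection_apply_mem u)) ?_)
    rw [← map_sub, Submodule.mem_orthogonal]
    intro z hz
    obtain ⟨A', hA', h⟩ := hstar A hA
    rw [inner_diagOp h]
    exact Submodule.mem_orthogonal V _ |>.1 (V.sub_starProjection_mem_orthogonal u) _
      (hV A' hA' z hz)
  -- By `hP` each matrix entry of `P` commutes with 𝒜, hence with `B` by hypothesis, and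
  -- `diagOp_comm` reassembles the entries.
  have hPB : ∀ u, P (diagOp ι B u) = diagOp ι B (P u) := by
    refine diagOp_comm fun i j x => ?_
    refine hB (entryOp P i j) (fun A hA x => ?_) x
    have hA' : PiLp.single 2 j (A x) = diagOp ι A (PiLp.single 2 j x) := by
      refine PiLp.ext fun k => ?_
      by_cases hk : k = j
      · subst hk; simp
      · simp [hk]
    rw [entryOp_apply, entryOp_apply, ← diagOp_apply, ← hP A hA, hA']
  -- Without a unit in 𝒜, the membership of `w` in `V` needs nondegeneracy: every `A` in 𝒜 kills
  -- each coordinate of w - Pw, since Aw ∈ V gives A(Pw) = P(Aw) = Aw.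
  have hw : P w = w := by
    refine (sub_eq_zero.1 ?_).symm
    refine PiLp.ext fun i => ?_
    refine hnd _ fun A hA => ?_
    rw [← diagOp_apply, map_sub, ← hP A hA, PiLp.sub_apply, sub_eq_zero]
    have : P (diagOp ι A w) = diagOp ι A w :=
      V.starProjection_eq_self_iff.2 (subset_closure ⟨A, hA, rfl⟩)
    rw [this]
  have hmem : diagOp ι B w ∈ V := by
    rw [← V.starProjection_eq_self_iff]
    exact (hPB w).trans (by rw [hw])
  obtain ⟨_, ⟨A, hA, rfl⟩, hlt⟩ := Metric.mem_closure_iff.1 hmem ε hε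
  refine ⟨A, hA, fun i => lt_of_le_of_lt ?_ hlt⟩
  rw [dist_comm, dist_eq_norm]
  exact PiLp.norm_apply_le (ev A - diagOp ι B w) i

/-- Von Neumann's double commutant theorem: the double commutant of a nondegenerate `*`-algebra of
operators is contained in its closure in the weak operator topology. -/
theorem ofCLM_mem_closure_of_commute_commutant (𝒜 : Submodule ℂ (H →L[ℂ] H))
    (hmul : ∀ A ∈ 𝒜, ∀ A' ∈ 𝒜, A.comp A' ∈ 𝒜)
    (hstar : ∀ A ∈ 𝒜, ∃ A' ∈ 𝒜, ∀ x y, ⟪x, A y⟫_ℂ = ⟪A' x, y⟫_ℂ)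
    (hnd : ∀ w, (∀ A ∈ 𝒜, A w = 0) → w = 0) {B : H →L[ℂ] H}
    (hB : ∀ T : H →L[ℂ] H, (∀ A ∈ 𝒜, ∀ x, T (A x) = A (T x)) → ∀ x, T (B x) = B (T x)) :
    ContinuousLinearMapWOT.ofCLM B ∈ closure (ContinuousLinearMapWOT.ofCLM ''
      (𝒜 : Set (H →L[ℂ] H))) := by
  refine mem_closure_iff_nhds.2 fun t ht => ?_
  obtain ⟨s, r, hr, hst⟩ := (ContinuousLinearMapWOT.withSeminorms.mem_nhds_iff _ _).1 ht
  -- A common bound for the norms of the finitely many functionals that define the weak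
  -- neighbourhood; the summand 1 keeps it positive when there are none.
  let C : ℝ := 1 + ∑ p ∈ s, ‖p.2‖
  have hC : 0 < C := by positivity
  -- The index set of the amplification is the finite set of pairs (vector, functional), and the
  -- vectors to be approximated are the first components.
  obtain ⟨A, hA, h⟩ := exists_norm_sub_lt_of_commute_commutant 𝒜 hmul hstar hnd hB
    (fun p : s => p.1.1) (div_pos hr hC)
  refine ⟨_, hst ?_, A, hA, rfl⟩
  rw [Seminorm.mem_ball]
  refine Seminorm.finset_sup_apply_lt hr fun p hp => ?_
  have h1 : ‖p.2 (A p.1 - B p.1)‖ ≤ ‖p.2‖ * ‖A p.1 - B p.1‖ := p.2.le_opNorm _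
  have h2 : ‖p.2‖ ≤ C := by
    have := Finset.single_le_sum (f := fun p : H × StrongDual ℂ H => ‖p.2‖)
      (fun _ _ => norm_nonneg _) hp
    change _ ≤ 1 + _
    linarith
  have h3 := h ⟨p, hp⟩
  change ‖p.2 (A p.1 - B p.1)‖ < r
  calc _ ≤ ‖p.2‖ * ‖A p.1 - B p.1‖ := h1
    _ ≤ C * ‖A p.1 - B p.1‖ := by gcongr
    _ < C * (r / C) := by gcongr
    _ = r := by field_simp

end Bicommutant
-- Moving a left factor across the pairing
namespace SourceManifolds

variable {S : SourceManifolds.{u, v}}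

/-- Both closed manifolds arise from the same sewing of `P`, `M`, `N`: the left ends of `P` and `M`,
the right end of `M` with the left end of `N`, and the right ends of `P` and `N`. This is the mirror
image of `pairing_prod_right`, and it will yield the adjoints of left operators. -/
theorem pairing_prod_left {B₁ B₂ B₃ : S.Bdry} (P : S.Surf ![B₁, B₃]) (M : S.Surf ![B₁, B₂])
    (N : S.Surf ![B₂, B₃]) :
    pairing P (prod M N) = pairing (prod (S.sew (Sewing.flip B₁ B₂) M) P) N := by
  obtain ⟨T, hT, hT', h⟩ := (isRename_assoc_symm P M N).trans ((isRename_comm P M).union_left N)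
  unfold pairing prod
  rw [union_sew_right, union_sew_left, union_sew_left, union_sew_left, h]
  -- `U` is the total pattern on P ⊔ (M ⊔ N). `V` is the same pattern on (M ⊔ P) ⊔ N, and `V'` is
  -- `V` with the two labels of `M` interchanged.
  let U : Sewing (Sum.elim ![B₁, B₃] (Sum.elim ![B₁, B₂] ![B₂, B₃]))
      (Empty.elim : Empty → S.Bdry) :=
    { keep := Empty.elim
      pair := Sum.elim ![.inr (.inl 0), .inr (.inr 1)]
        (Sum.elim ![.inl 0, .inr (.inr 0)] ![.inr (.inl 1), .inl 1])
      pair_pair := by decide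
      keep_injective := fun x => x.elim
      pair_eq_iff := by simp only [Set.mem_range]; decide
      color_pair := by rintro (i | i | i) <;> fin_cases i <;> rfl
      color_keep := fun x => x.elim }
  let V : Sewing (Sum.elim (Sum.elim ![B₁, B₂] ![B₁, B₃]) ![B₂, B₃])
      (Empty.elim : Empty → S.Bdry) :=
    { keep := Empty.elim
      pair := Sum.elim (Sum.elim ![.inl (.inr 0), .inr 0] ![.inl (.inl 0), .inr 1])
        ![.inl (.inl 1), .inl (.inr 1)]
      pair_pair := by decide
      keep_injective := fun x => x.elim
      pair_eq_iff := by simp only [Set.mem_range]; decide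
      color_pair := by rintro ((i | i) | i) <;> fin_cases i <;> rfl
      color_keep := fun x => x.elim }
  let V' : Sewing (Sum.elim (Sum.elim ![B₂, B₁] ![B₁, B₃]) ![B₂, B₃])
      (Empty.elim : Empty → S.Bdry) :=
    { keep := Empty.elim
      pair := Sum.elim (Sum.elim ![.inr 0, .inl (.inr 0)] ![.inl (.inl 1), .inr 1])
        ![.inl (.inl 0), .inl (.inr 1)]
      pair_pair := by decide
      keep_injective := fun x => x.elim
      pair_eq_iff := by simp only [Set.mem_range]; decide
      color_pair := by rintro ((i | i) | i) <;> fin_cases i <;> rfl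
      color_keep := fun x => x.elim }
  rw [sew_sew_eq U, sew_sew_eq V', sew_sew_eq V, sew_sew_eq U]
  · exact fun k => k.elim
  · rintro ((i | i) | i) <;> simp only [hT] <;> fin_cases i <;> rfl
  · intro i h; exact absurd (hT' i) h
  · exact fun k => k.elim
  · rintro ((i | i) | i) <;> fin_cases i <;> rfl
  · rintro ((i | i) | i) h <;> fin_cases i <;> exact absurd rfl h
  · exact fun k => k.elim
  · rintro (i | i) <;> fin_cases i <;> rfl
  · rintro ((i | i) | i) h <;> fin_cases i <;> first | rfl | exact absurd rfl h
  · exact fun k => k.elim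
  · rintro (i | i) <;> fin_cases i <;> rfl
  · rintro (i | i | i) h <;> fin_cases i <;> first | rfl | exact absurd rfl h

end SourceManifolds

noncomputable section

namespace PathIntegral

open SourceManifolds

variable {S : SourceManifolds.{u, v}} (Z : PathIntegral S) {B₁ B₂ B₃ BL BR : S.Bdry}

/-! ### Left operators: adjoints, products and nondegeneracy -/

theorem pairH_mul_left (z : Z.PreH ![B₁, B₃]) (x : Z.PreH ![B₁, B₂]) (y : Z.PreH ![B₂, B₃]) :
    Z.pairH z (Z.mul x y) = Z.pairH (Z.mul (Z.sewH (Sewing.flip B₁ B₂) x) z) y := by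
  induction z using PreH.induction with
  | h0 => simp
  | hadd u v h h' => simp only [map_add, LinearMap.add_apply, h, h']
  | hsurf a M =>
    simp only [map_smul, LinearMap.smul_apply]
    congr 1
    induction y using PreH.induction with
    | h0 => simp
    | hadd u v h h' => simp only [map_add, h, h']
    | hsurf b N =>
      simp only [map_smul]
      congr 1
      induction x using PreH.induction with
      | h0 => simp
      | hadd u v h h' => simp only [map_add, LinearMap.add_apply, h, h']
      | hsurf a M' =>
        simp only [map_smul, LinearMap.smul_apply]
        congr 1
        simp [pairing_prod_left]

theorem inner_mul_left (z : Z.PreH ![B₁, B₃]) (x : Z.PreH ![B₁, B₂]) (y : Z.PreH ![B₂, B₃]) :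
    ⟪z, Z.mul x y⟫_ℂ = ⟪Z.mul (Z.starH x) z, y⟫_ℂ := by
  rw [inner_def, inner_def, pairH_mul_left, conjH_mul, starH, conjH_conjH]

/-- The adjoint of `â_L` is the operator of `a⋆`. -/
theorem inner_leftOp (a : Z.PreH ![B₁, B₂]) (y : Z.Hilb ![B₁, B₃]) (x : Z.Hilb ![B₂, B₃]) :
    ⟪y, Z.leftOp B₃ a x⟫_ℂ = ⟪Z.leftOp B₃ (Z.starH a) y, x⟫_ℂ := by
  revert x
  refine congrFun (Z.ext_ket (by fun_prop) (by fun_prop) fun x => ?_)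
  revert y
  refine congrFun (Z.ext_ket (by fun_prop) (by fun_prop) fun y => ?_)
  rw [leftOp_ket, leftOp_ket, inner_ket, inner_ket, inner_mul_left]

theorem leftOp_comp (a b : Z.PreH ![BL, BL]) :
    (Z.leftOp BR a).comp (Z.leftOp BR b) = Z.leftOp BR (Z.mul a b) := by
  refine DFunLike.coe_injective (Z.ext_ket (ContinuousLinearMap.continuous _)
    (ContinuousLinearMap.continuous _) fun x => ?_)
  simp [mul_assoc']

/-- The linear map `a ↦ â_L`. -/
def leftOpₗ (B₁ B₂ B₃ : S.Bdry) :
    Z.PreH ![B₁, B₂] →ₗ[ℂ] (Z.Hilb ![B₂, B₃] →L[ℂ] Z.Hilb ![B₁, B₃]) where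
  toFun := Z.leftOp B₃
  map_add' a b := DFunLike.coe_injective (Z.ext_ket (Z.leftOp B₃ (a + b)).continuous
    (Z.leftOp B₃ a + Z.leftOp B₃ b).continuous fun φ => by simp)
  map_smul' t a := DFunLike.coe_injective (Z.ext_ket (Z.leftOp B₃ (t • a)).continuous
    (t • Z.leftOp B₃ a).continuous fun φ => by simp)

/-- The finitely many surfaces in ψ have a rim of common length. That the left factor is a cylinder
is forgotten, since `Phi_ket_mul` holds for any left factor. -/
theorem exists_eq_mul (ψ : Z.PreH ![BL, BR]) :
    ∃ (C : Z.PreH ![BL, BL]) (φ : Z.PreH ![BL, BR]), ψ = Z.mul C φ := by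
  obtain ⟨e, he, h⟩ := Z.exists_common_rim ψ
  exact ⟨_, h (e / 2) (by linarith) (by linarith)⟩

theorem eq_zero_of_inner_ket {ι : Type} [Finite ι] {c : ι → S.Bdry} {w : Z.Hilb c}
    (h : ∀ x, ⟪Z.ket x, w⟫_ℂ = 0) : w = 0 :=
  ext_inner_left ℂ fun y => congrFun (Z.ext_ket (f := fun y => ⟪y, w⟫_ℂ)
    (g := fun y => ⟪y, (0 : Z.Hilb c)⟫_ℂ) (by fun_prop) (by fun_prop) (by simpa using h)) y

/-- The left surface algebra acts nondegenerately on `𝓗_LR`. -/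
theorem eq_zero_of_leftOp {w : Z.Hilb ![BL, BR]}
    (h : ∀ a : Z.PreH ![BL, BL], Z.leftOp BR a w = 0) : w = 0 := by
  refine Z.eq_zero_of_inner_ket fun x => ?_
  obtain ⟨C, φ, rfl⟩ := Z.exists_eq_mul x
  rw [← leftOp_ket, ← inner_conj_symm, inner_leftOp, h, inner_zero_left, map_zero]

/-- The operator of φ⋆ is the adjoint of φ̂_R. By rimming every ket has the form |Cφ⟩ = φ̂_R|C⟩, so
a vector killed by all these adjoints is orthogonal to every ket. -/
theorem eq_zero_of_rightOp_starH {w : Z.Hilb ![BL, BR]}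
    (h : ∀ φ : Z.PreH ![BL, BR], Z.rightOp BL (Z.starH φ) w = 0) : w = 0 := by
  refine Z.eq_zero_of_inner_ket fun x => ?_
  obtain ⟨C, φ, rfl⟩ := Z.exists_eq_mul x
  rw [← rightOp_ket, ← inner_conj_symm, inner_rightOp, ← inner_conj_symm, h]
  simp

/-! ### Φ(a) belongs to the left von Neumann algebra -/

/-- Associativity of sewing, (xw)φ = x(wφ). The boundaries are left general because both φ̂_R : 𝓗_LL
→ 𝓗_LR and the operator of χ⋆ in the opposite direction are needed. -/
theorem leftOp_rightOp (x : Z.PreH ![BL, B₁]) (φ : Z.PreH ![B₂, B₃]) (w : Z.Hilb ![B₁, B₂]) :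
    Z.rightOp BL φ (Z.leftOp B₂ x w) = Z.leftOp B₃ x (Z.rightOp B₁ φ w) := by
  revert w
  refine congrFun (Z.ext_ket (by fun_prop) (by fun_prop) fun w => ?_)
  simp [mul_assoc']

/-- `Φ_LR(a)` intertwines with the operators `φ̂_R`. -/
theorem Phi_rightOp (a : Z.leftAlgebra BL BL) (φ : Z.PreH ![BL, BR]) (x : Z.Hilb ![BL, BL]) :
    Z.Phi BR a (Z.rightOp BL φ x) = Z.rightOp BL φ (a.1 x) := by
  revert x
  refine congrFun (Z.ext_ket (by fun_prop) (by fun_prop) fun x => ?_)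
  rw [rightOp_ket, Phi_ket_mul]

/-- The companion of `Phi_rightOp` for adjoints of right operators, obtained without knowing how Φ
acts on adjoints. The product of φ̂_R and the operator of χ⋆ is the right operator of φχ⋆ on 𝓗_LL,
and this commutes with `a`. -/
theorem rightOp_starH_Phi (a : Z.leftAlgebra BL BL) (χ : Z.PreH ![BL, BR])
    (w : Z.Hilb ![BL, BR]) :
    Z.rightOp BL (Z.starH χ) (Z.Phi BR a w) = a.1 (Z.rightOp BL (Z.starH χ) w) := by
  revert w
  refine congrFun (Z.ext_ket (by fun_prop) (by fun_prop) fun w => ?_)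
  obtain ⟨C, φ, rfl⟩ := Z.exists_eq_mul w
  have h : ∀ u : Z.Hilb ![BL, BL], Z.rightOp BL (Z.starH χ) (Z.rightOp BL φ u) =
      Z.rightOp BL (Z.mul φ (Z.starH χ)) u :=
    congrFun (Z.ext_ket (by fun_prop) (by fun_prop) fun u => by simp [mul_assoc'])
  rw [Phi_ket_mul, h, leftAlgebra_commute, ← h, rightOp_ket]

/-- An operator commuting with all `â_L` commutes with the von Neumann algebra they generate. -/
theorem leftAlgebra_commute_of_leftOp_commute (a : Z.leftAlgebra BL BR)
    (T : Z.Hilb ![BL, BR] →L[ℂ] Z.Hilb ![BL, BR])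
    (hT : ∀ (x : Z.PreH ![BL, BL]) w, T (Z.leftOp BR x w) = Z.leftOp BR x (T w))
    (w : Z.Hilb ![BL, BR]) : T (a.1 w) = a.1 (T w) := by
  refine ext_inner_left ℂ fun v => ?_
  revert a
  refine Z.leftAlgebra_induction (p := fun a => ⟪v, T (a w)⟫_ℂ = ⟪v, a (T w)⟫_ℂ) ?_ ?_
  · refine isClosed_eq ?_ ?_
    · exact ContinuousLinearMapWOT.continuous_dual_apply w ((innerSL ℂ v).comp T)
    · exact ContinuousLinearMapWOT.continuous_dual_apply _ (innerSL ℂ v)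
  · intro x
    rw [hT]

/-- Conjugating by right operators moves the question from 𝓗_LR to 𝓗_LL, where `a` commutes with
everything that commutes with the left operators. -/
theorem Phi_commute_of_leftOp_commute (a : Z.leftAlgebra BL BL)
    (T : Z.Hilb ![BL, BR] →L[ℂ] Z.Hilb ![BL, BR])
    (hT : ∀ (x : Z.PreH ![BL, BL]) w, T (Z.leftOp BR x w) = Z.leftOp BR x (T w))
    (w : Z.Hilb ![BL, BR]) : T (Z.Phi BR a w) = Z.Phi BR a (T w) := by
  revert w
  refine congrFun (Z.ext_ket (by fun_prop) (by fun_prop) fun w => ?_)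
  obtain ⟨C, φ, rfl⟩ := Z.exists_eq_mul w
  rw [← sub_eq_zero]
  -- The ket is φ̂_R|C⟩. After testing against χ⋆, the claim becomes that `a` commutes with χ̂_R^* T
  -- φ̂_R, applied to |C⟩.
  refine Z.eq_zero_of_rightOp_starH fun χ => ?_
  rw [map_sub, sub_eq_zero, rightOp_starH_Phi, ← rightOp_ket, Phi_rightOp]
  exact Z.leftAlgebra_commute_of_leftOp_commute a
    ((Z.rightOp BL (Z.starH χ)).comp (T.comp (Z.rightOp BL φ)))
    (fun x w => by simp [leftOp_rightOp, hT]) (Z.ket C)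

/-- The double commutant theorem for the range of a ↦ â_L: closed under products by associativity,
under adjoints by ⋆, and nondegenerate by rimming. -/
theorem Phi_mem_leftAlgebra (a : Z.leftAlgebra BL BL) : Z.Phi BR a ∈ Z.leftAlgebra BL BR := by
  refine ofCLM_mem_closure_of_commute_commutant (LinearMap.range (Z.leftOpₗ BL BL BR)) ?_ ?_ ?_ ?_
  · rintro _ ⟨x, rfl⟩ _ ⟨y, rfl⟩
    exact ⟨Z.mul x y, (Z.leftOp_comp x y).symm⟩
  · rintro _ ⟨x, rfl⟩
    exact ⟨_, ⟨Z.starH x, rfl⟩, Z.inner_leftOp x⟩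
  · exact fun w hw => Z.eq_zero_of_leftOp fun x => hw _ ⟨x, rfl⟩
  · exact fun T hT => Z.Phi_commute_of_leftOp_commute a T fun x => hT _ ⟨x, rfl⟩

/-! ### Boundedness of Ψ_R, its extension, and intertwining -/

/-- The trace inequality gives the bound on kets, and the inequality is a closed condition on the
vector. -/
theorem norm_rightOp_le (a : Z.PreH ![B₂, B₃]) : ‖Z.rightOp B₁ a‖ ≤ ‖a‖ := by
  refine ContinuousLinearMap.opNorm_le_bound _ (norm_nonneg a) fun x => ?_
  induction x using Z.denseRange_ket.induction_on with
  | hp => exact isClosed_le (by fun_prop) (by fun_prop)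
  | ih x => simpa [mul_comm] using Z.norm_mul_le x a

theorem norm_PsiR_le (a : Z.D ![BL, BR]) : ‖Z.PsiR BL BR a‖ ≤ 1 * ‖a‖ := by
  obtain ⟨a, rfl⟩ := Z.toD_surjective a
  rw [PsiR_toD, one_mul]
  exact (Z.norm_rightOp_le a).trans_eq (SeparationQuotient.norm_mk a).symm

/-- `Ψ_R` as a bounded operator for the operator norm. -/
def PsiRL (BL BR : S.Bdry) :
    Z.D ![BL, BR] →L[ℂ] (Z.Hilb ![BL, BL] →L[ℂ] Z.Hilb ![BL, BR]) :=
  (Z.PsiR BL BR).mkContinuous 1 Z.norm_PsiR_le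

/-- The extension of `Ψ_R` to `𝓗_LR`. -/
def PsiRExt (BL BR : S.Bdry) :
    Z.Hilb ![BL, BR] →L[ℂ] (Z.Hilb ![BL, BL] →L[ℂ] Z.Hilb ![BL, BR]) :=
  (Z.PsiR BL BR).extendOfNorm Z.toHilb.toLinearMap

theorem PsiRExt_toHilb (a : Z.D ![BL, BR]) : Z.PsiRExt BL BR (Z.toHilb a) = Z.PsiR BL BR a :=
  LinearMap.extendOfNorm_eq Z.denseRange_toHilb
    ⟨1, fun x => (Z.norm_PsiR_le x).trans_eq (by simp)⟩ a

/-- The strong operator topology is induced from the product topology on functions H → K. -/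
theorem strongContinuous_iff {X H K : Type*} [TopologicalSpace X] [NormedAddCommGroup H]
    [InnerProductSpace ℂ H] [NormedAddCommGroup K] [InnerProductSpace ℂ K] {F : X → (H →L[ℂ] K)} :
    StrongContinuous F ↔ ∀ x, Continuous fun p => F p x :=
  (PointwiseConvergenceCLM.isInducing_inducingFn (RingHom.id ℂ) H K).continuous_iff.trans continuous_pi_iff

/-- At a fixed vector both sides are continuous in ψ, and on kets the identity is `Phi_rightOp`. -/
theorem PsiRExt_intertwines (ψ : Z.Hilb ![BL, BR]) (a : Z.leftAlgebra BL BL) :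
    (Z.Phi BR a).comp (Z.PsiRExt BL BR ψ) = (Z.PsiRExt BL BR ψ).comp a.1 := by
  ext x
  revert ψ
  refine congrFun (Z.ext_ket (by fun_prop) (by fun_prop) fun φ => ?_)
  rw [ket_eq, PsiRExt_toHilb, PsiR_toD]
  exact Z.Phi_rightOp a φ x

end PathIntegral

end

theorem mainTheorem7 (S : SourceManifolds.{u, v}) (Z : PathIntegral S) (BL BR : S.Bdry) :
    PathIntegral.StrongContinuous (fun ψ : Z.D ![BL, BR] => Z.PsiR BL BR ψ) ∧
    ∃ Ψ : Z.Hilb ![BL, BR] →ₗ[ℂ] (Z.Hilb ![BL, BL] →L[ℂ] Z.Hilb ![BL, BR]),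
      PathIntegral.StrongContinuous (fun ψ : Z.Hilb ![BL, BR] => Ψ ψ) ∧
      (∀ a : Z.D ![BL, BR], Ψ (Z.toHilb a) = Z.PsiR BL BR a) ∧
      (∀ Ψ' : Z.Hilb ![BL, BR] → (Z.Hilb ![BL, BL] →L[ℂ] Z.Hilb ![BL, BR]),
        PathIntegral.StrongContinuous Ψ' →
        (∀ a : Z.D ![BL, BR], Ψ' (Z.toHilb a) = Z.PsiR BL BR a) →
        ∀ ψ, Ψ' ψ = Ψ ψ) ∧
      (∀ a : Z.leftAlgebra BL BL, Z.Phi BR a ∈ Z.leftAlgebra BL BR) ∧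
      (∀ (ψ : Z.Hilb ![BL, BR]) (a : Z.leftAlgebra BL BL),
        (Z.Phi BR a).comp (Ψ ψ) = (Ψ ψ).comp a.1) := by
  refine ⟨PathIntegral.strongContinuous_iff.2 fun x => ?_, (Z.PsiRExt BL BR).toLinearMap,
    PathIntegral.strongContinuous_iff.2 fun x => ?_, Z.PsiRExt_toHilb, fun Ψ' hΨ' h ψ => ?_,
    Z.Phi_mem_leftAlgebra, Z.PsiRExt_intertwines⟩
  -- Continuity for the operator norm implies continuity at each vector.
  · exact (Z.PsiRL BL BR).continuous.clm_apply continuous_const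
  · exact (Z.PsiRExt BL BR).continuous.clm_apply continuous_const
  · ext x
    -- Uniqueness is checked at each vector, where the values lie in a Hausdorff space; linearity of
    -- the competitor plays no role.
    refine congrFun (Z.denseRange_toHilb.equalizer (PathIntegral.strongContinuous_iff.1 hΨ' x)
      ((Z.PsiRExt BL BR).continuous.clm_apply continuous_const) (funext fun a => ?_)) ψ
    exact congrArg (fun F => F x) ((h a).trans (Z.PsiRExt_toHilb a).symm)
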